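/- Let $M$ be an $N$-dimensional K\"ahler manifold with metric $g_{k\bar l}$, given locally by K\"ahler potentials, $g_{k\bar l}=\partial_k\partial_{\bar l}\Phi$, and assume that $M$ is locally symmetric, $\nabla R=0$. Write $g^{\bar k l}$ for the inverse metric ($g^{\bar k l}g_{l\bar m}=\delta_{\bar k\bar m}$), and put $$D^k=g^{k\bar m}\partial_{\bar m},\qquad D^{\bar j}=g^{\bar j l}\partial_l,\qquad D^{\vec\alpha}=\prod_k (D^k)^{\alpha_k},\qquad D^{\vec\beta^*}=\prod_j (D^{\bar j})^{\beta_j},$$ for multi-indices $\vec\alpha,\vec\beta\in\mathbb Z_{\ge0}^N$, with $D^{\vec\gamma}=D^{\vec\gamma^*}=0$ if $\vec\gamma\in\mathbb Z^N$ has a negative entry. Let $\vec e_k$ be the $k$-th unit vector, and let $$R_{i\bar jk\bar l}=-\partial_k\partial_{\bar l}g_{i\bar j}+g^{p\bar q}\,\partial_kg_{i\bar q}\,\partial_{\bar l}g_{p\bar j},\qquad {{R_{\bar a}}^{\bar c\bar d}}_{\bar b}=g^{P\bar c}g^{Q\bar d}R_{\bar aPQ\bar b},\quad R_{\bar aPQ\bar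 b}=-R_{P\bar aQ\bar b}.$$ Let $U$ be the domain of a holomorphic coordinate chart of $M$. Let $T=(T^n_{\vec\alpha\vec\beta^*})_{n\ge0,\ |\vec\alpha|=|\vec\beta|=n}$ be formal power series in $\hbar$ whose coefficients are smooth functions on an open set $V\subset U$, such that locally on $V$ each power of $\hbar$ occurs in $T^n$ for only finitely many $n$. Call $T$ covariantly constant if all coefficients of powers of $\hbar$ in the symmetric tensors with components $\frac{\vec\alpha!}{n!}\frac{\vec\beta!}{n!}T^n_{\vec\alpha\vec\beta^*}$ (those which $T^n$ contracts with $D^{i_1}\cdots D^{i_n}f\;D^{\bar j_1}\cdots D^{\bar j_n}g$) are covariantly constant. For smooth $f,g$ on $V$ put $$L^T_fg=\sum_{n=0}^\infty\sum_{|\vec\alpha|=|\vec\beta|=n}T^n_{\vec\alpha\vec\beta^*}\,(D^{\vec\alpha}f)(D^{\vec\beta^*}g),$$ \begin{align*} \mathcal R_i^T(f,g)={}&\sum_{n=0}^\infty\sum_{|\vec\alpha|=|\vec\beta|=n}\beta_iT^n_{\vec\alpha\vec\beta^*}(D^{\vec\alpha}f)(D^{\vec\beta^*-\vec e_i}g)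 -\hbar\sum_{n=0}^\infty\sum_{|\vec\alpha|=|\vec\beta|=n}\sum_{d=1}^Ng_{\bar id}T^n_{\vec\alpha\vec\beta^*}(D^{\vec\alpha+\vec e_d}f)(D^{\vec\beta^*}g)\\ &+\hbar\sum_{n=0}^\infty\sum_{|\vec\alpha|=|\vec\beta|=n}\sum_{k=1}^N\sum_{p=1}^N\frac{\beta_k(\beta_k-1)}2{{R_{\bar p}}^{\bar k\bar k}}_{\bar i}T^n_{\vec\alpha\vec\beta^*}(D^{\vec\alpha}f)(D^{\vec\beta^*+\vec e_p-2\vec e_k}g)\\ &+\hbar\sum_{n=0}^\infty\sum_{|\vec\alpha|=|\vec\beta|=n}\sum_{\rho=1}^N\sum_{k=1}^{N-1}\sum_{l=1}^{N-k}\beta_k\beta_{k+l}{{R_{\bar\rho}}^{\overline{k+l}\,\bar k}}_{\bar i}T^n_{\vec\alpha\vec\beta^*}(D^{\vec\alpha}f)(D^{\vec\beta^*+\vec e_\rho-\vec e_k-\vec e_{k+l}}g). \end{align*} (1) If $V\subset U$ is open, $\Phi$ is a K\"ahler potential on $V$, and $T$ is covariantly constant on $V$, then for all smooth $f,g$ on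 $V$ and all $i=1,\dots,N$ $$[L^T_f,\ \partial_{\bar i}\Phi+\hbar\partial_{\bar i}]\,g=\mathcal R^T_i(f,g)\quad\text{on }V .$$ (2) Let $*$ be a star product with separation of variables on $M$ (with $f*a$, resp. $a*f$, equal to $fa$ for antiholomorphic, resp. holomorphic, $a$) which satisfies Karabegov's condition: the operators $L_f=f*\cdot$ commute with $\partial_{\bar i}\Phi+\hbar\partial_{\bar i}$ for all $i$ and every local K\"ahler potential $\Phi$. Suppose that on $U$ it has the form $f*g=L^T_fg$ with $T$ covariantly constant on $U$. Then for every open $V\subset U$, all smooth $f,g$ on $V$ and all $i$, $$\mathcal R^T_i(f,g)=0\quad\text{on }V ,$$ and these relations determine $T$: if a family $T'$ of smooth coefficients on $U$ as above (covariantly constant or not) has $T'^0_{\vec0\vec0}=1$ and satisfies $\mathcal R^{T'}_i(f,g)=0$ on $U$ for all smooth $f,g$ on $U$ and all $i$, then $T'=T$. -/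

import Mathlib

open scoped ContDiff Manifold Topology PowerSeries

noncomputable section

namespace KahlerStar

/-! ### Calculus in complex coordinates -/

/-- The coordinate space `ℂ^N`. -/
abbrev Cn (N : ℕ) : Type := Fin N → ℂ

/-- The Wirtinger derivative `∂_k = ∂/∂z^k = (∂/∂x^k - i ∂/∂y^k) / 2`. -/
def dz {N : ℕ} (k : Fin N) (f : Cn N → ℂ) : Cn N → ℂ := fun z =>
  (1 / 2 : ℂ) * (fderiv ℝ f z (Pi.single k 1) - Complex.I * fderiv ℝ f z (Pi.single k Complex.I))

/-- The Wirtinger derivative `∂_{k̄} = ∂/∂z̄^k = (∂/∂x^k + i ∂/∂y^k) / 2`. -/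
def dzbar {N : ℕ} (k : Fin N) (f : Cn N → ℂ) : Cn N → ℂ := fun z =>
  (1 / 2 : ℂ) * (fderiv ℝ f z (Pi.single k 1) + Complex.I * fderiv ℝ f z (Pi.single k Complex.I))

/-- `A_1^{α_1} A_2^{α_2} ⋯ A_N^{α_N} f` for operators `A_1, …, A_N` and a multi-index `α`. -/
def multiPow {N : ℕ} (A : Fin N → (Cn N → ℂ) → (Cn N → ℂ)) (α : Fin N → ℕ)
    (f : Cn N → ℂ) : Cn N → ℂ :=
  (List.ofFn fun k => (A k)^[α k]).foldr (fun B h => B h) f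

/-- The multi-index `e_k`. -/
def unitIdx {N : ℕ} (k : Fin N) : Fin N → ℕ := Pi.single k 1

/-- The finite set of multi-indices `α ∈ ℕ^N` with `α_1 + ⋯ + α_N = n`. -/
def idx (N n : ℕ) : Finset (Fin N → ℕ) := Finset.piAntidiag Finset.univ n

/-! ### Tensor calculus of a Kähler metric in a coordinate domain

Throughout, `G z k l` is the component `g_{k l̄}` at the point with coordinates `z`, so that
`(G z)⁻¹ k l` is `g^{k̄ l} = g^{l k̄}`, because `g^{k̄ l} g_{l m̄} = δ_{k̄ m̄}`. -/

/-- `D^k = g^{k m̄} ∂_{m̄}`. -/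
def Dhol {N : ℕ} (G : Cn N → Matrix (Fin N) (Fin N) ℂ) (k : Fin N) (f : Cn N → ℂ) :
    Cn N → ℂ := fun z => ∑ m, (G z)⁻¹ m k * dzbar m f z

/-- `D^{j̄} = g^{j̄ l} ∂_l`. -/
def Dbar {N : ℕ} (G : Cn N → Matrix (Fin N) (Fin N) ℂ) (j : Fin N) (f : Cn N → ℂ) :
    Cn N → ℂ := fun z => ∑ l, (G z)⁻¹ j l * dz l f z

/-- The Christoffel symbol `Γ^l_{jk} = g^{l q̄} ∂_k g_{j q̄}`. -/
def christoffel {N : ℕ} (G : Cn N → Matrix (Fin N) (Fin N) ℂ) (l j k : Fin N) : Cn N → ℂ :=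
  fun z => ∑ q, (G z)⁻¹ q l * dz k (fun w => G w j q) z

/-- The conjugate Christoffel symbol `Γ^{l̄}_{j̄k̄} = g^{l̄ q} ∂_{k̄} g_{q j̄}`. -/
def christoffelBar {N : ℕ} (G : Cn N → Matrix (Fin N) (Fin N) ℂ) (l j k : Fin N) : Cn N → ℂ :=
  fun z => ∑ q, (G z)⁻¹ l q * dzbar k (fun w => G w q j) z

/-- A tensor field with `a` lower holomorphic and `b` lower antiholomorphic indices, given by its
components `Y_{ν_1 ⋯ ν_a ν̄_1 ⋯ ν̄_b}`. -/
abbrev LowerTensor (N a b : ℕ) : Type := (Fin a → Fin N) → (Fin b → Fin N) → Cn N → ℂ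

/-- The components of `∇_m Y`. The Christoffel symbols of mixed type vanish. -/
def nabla {N a b : ℕ} (G : Cn N → Matrix (Fin N) (Fin N) ℂ) (Y : LowerTensor N a b)
    (m : Fin N) : LowerTensor N a b := fun I J z =>
  dz m (Y I J) z
    - ∑ q : Fin a, ∑ s : Fin N, christoffel G s m (I q) z * Y (Function.update I q s) J z

/-- The components of `∇_{m̄} Y`. -/
def nablaBar {N a b : ℕ} (G : Cn N → Matrix (Fin N) (Fin N) ℂ) (Y : LowerTensor N a b)
    (m : Fin N) : LowerTensor N a b := fun I J z =>
  dzbar m (Y I J) z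
    - ∑ q : Fin b, ∑ s : Fin N, christoffelBar G s m (J q) z * Y I (Function.update J q s) z

/-- `Y` is covariantly constant on `U`. -/
def IsParallel {N a b : ℕ} (G : Cn N → Matrix (Fin N) (Fin N) ℂ) (U : Set (Cn N))
    (Y : LowerTensor N a b) : Prop :=
  ∀ m I J, ∀ z ∈ U, nabla G Y m I J z = 0 ∧ nablaBar G Y m I J z = 0

/-- The Riemannian curvature
`R_{i j̄ k l̄} = - ∂_k ∂_{l̄} g_{i j̄} + g^{p q̄} (∂_k g_{i q̄}) (∂_{l̄} g_{p j̄})`. -/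
def curv {N : ℕ} (G : Cn N → Matrix (Fin N) (Fin N) ℂ) (i j k l : Fin N) : Cn N → ℂ := fun z =>
  - dz k (dzbar l fun w => G w i j) z
    + ∑ p, ∑ q, (G z)⁻¹ q p * dz k (fun w => G w i q) z * dzbar l (fun w => G w p j) z

/-- The curvature as a tensor field, the holomorphic indices `i, k` being listed first. -/
def curvTensor {N : ℕ} (G : Cn N → Matrix (Fin N) (Fin N) ℂ) : LowerTensor N 2 2 :=
  fun I J => curv G (I 0) (J 0) (I 1) (J 1)

/-- `R_{ā}^{c̄ d̄}_{b̄} = g^{P c̄} g^{Q d̄} R_{ā P Q b̄}`, where `R_{ā P Q b̄} = - R_{P ā Q b̄}`. -/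
def curvMixed {N : ℕ} (G : Cn N → Matrix (Fin N) (Fin N) ℂ) (a c d b : Fin N) : Cn N → ℂ :=
  fun z => ∑ P, ∑ Q, (G z)⁻¹ c P * (G z)⁻¹ d Q * (- curv G P a Q b z)

/-- `Φ` is a Kähler potential on `V`: a real smooth function with `g_{k l̄} = ∂_k ∂_{l̄} Φ`. -/
def IsPotential {N : ℕ} (G : Cn N → Matrix (Fin N) (Fin N) ℂ) (V : Set (Cn N))
    (Φ : Cn N → ℝ) : Prop :=
  ContDiffOn ℝ ∞ Φ V ∧
    ∀ z ∈ V, ∀ k l, G z k l = dz k (dzbar l fun w => (Φ w : ℂ)) z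

/-! ### Formal power series in `ħ` and the bidifferential sums

The formal parameter `ħ` is the variable `PowerSeries.X`. -/

/-- The sum of a sequence of formal power series of which only finitely many contribute to each
power of `ħ`. -/
def formalSum (F : ℕ → ℂ⟦X⟧) : ℂ⟦X⟧ :=
  PowerSeries.mk fun m => ∑ᶠ n, PowerSeries.coeff m (F n)

/-- A family `T^n_{α β}`, with `|α| = |β| = n`, of formal power series in `ħ` whose coefficients
are functions of the coordinates. Values for other `α`, `β` are irrelevant. -/
abbrev Coeffs (N : ℕ) : Type := ℕ → (Fin N → ℕ) → (Fin N → ℕ) → Cn N → ℂ⟦X⟧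

/-- `∑_n ∑_{|α|=|β|=n} T^n_{αβ} (D^α f) (D^{β*} g)`. -/
def starSum {N : ℕ} (G : Cn N → Matrix (Fin N) (Fin N) ℂ) (T : Coeffs N)
    (f g : Cn N → ℂ) : Cn N → ℂ⟦X⟧ := fun z =>
  formalSum fun n => ∑ α ∈ idx N n, ∑ β ∈ idx N n,
    (multiPow (Dhol G) α f z * multiPow (Dbar G) β g z) • T n α β z

/-- The `T^n_{αβ}` are smooth on `U`, and locally on `U` each power of `ħ` occurs in `T^n` for
finitely many `n` only; thus the coefficients of `starSum` are bidifferential operators. -/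
structure IsCoeffFamily {N : ℕ} (U : Set (Cn N)) (T : Coeffs N) : Prop where
  smooth : ∀ n, ∀ α ∈ idx N n, ∀ β ∈ idx N n, ∀ m,
    ContDiffOn ℝ ∞ (fun z => PowerSeries.coeff m (T n α β z)) U
  locally_finite : ∀ m, ∀ z ∈ U, ∃ n₀ : ℕ, ∀ᶠ w in 𝓝 z, ∀ n ≥ n₀,
    ∀ α ∈ idx N n, ∀ β ∈ idx N n, PowerSeries.coeff m (T n α β w) = 0

/-- The multi-index that counts how often each value occurs in a list of `n` indices. -/
def countIdx {N n : ℕ} (I : Fin n → Fin N) : Fin N → ℕ := fun k =>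
  (Finset.univ.filter fun q => I q = k).card

/-- The symmetric tensor field `t_{i_1 ⋯ i_n j̄_1 ⋯ j̄_n}` that the coefficients at `ħ^m` of the
`T^n_{αβ}` represent, i.e. the one with
`∑_{αβ} T^n_{αβ} D^α f D^{β*} g = t_{i_1 ⋯ i_n j̄_1 ⋯ j̄_n} D^{i_1} ⋯ D^{i_n} f D^{j̄_1} ⋯ D^{j̄_n} g`.
Its components are `(α! / n!) (β! / n!) T^n_{αβ}`. -/
def coeffTensor {N : ℕ} (T : Coeffs N) (n m : ℕ) : LowerTensor N n n := fun I J z =>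
  ((∏ k, (countIdx I k).factorial : ℕ) : ℂ) / (n.factorial : ℂ)
    * (((∏ k, (countIdx J k).factorial : ℕ) : ℂ) / (n.factorial : ℂ))
    * PowerSeries.coeff m (T n (countIdx I) (countIdx J) z)

/-- The `T^n_{αβ}` are covariantly constant on `U`. -/
def CovariantlyConstant {N : ℕ} (G : Cn N → Matrix (Fin N) (Fin N) ℂ) (U : Set (Cn N))
    (T : Coeffs N) : Prop :=
  ∀ n m, IsParallel G U (coeffTensor T n m)

/-- `([L, ∂_{ī}Φ + ħ ∂_{ī}] g)(z)` for an operator `L` from functions to formal power series of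
functions, extended linearly over `ℂ⟦ħ⟧`. -/
def commutator {N : ℕ} (Φ : Cn N → ℝ) (i : Fin N) (L : (Cn N → ℂ) → Cn N → ℂ⟦X⟧)
    (g : Cn N → ℂ) : Cn N → ℂ⟦X⟧ := fun z =>
  (L (fun w => dzbar i (fun v => (Φ v : ℂ)) w * g w) z + PowerSeries.X * L (dzbar i g) z)
    - (dzbar i (fun v => (Φ v : ℂ)) z • L g z
      + PowerSeries.X *
          PowerSeries.mk fun m => dzbar i (fun w => PowerSeries.coeff m (L g w)) z)

/-- The left-hand side of the recurrence relation with index `i`, at the point `z`. -/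
def recurrence {N : ℕ} (G : Cn N → Matrix (Fin N) (Fin N) ℂ) (T : Coeffs N) (i : Fin N)
    (f g : Cn N → ℂ) : Cn N → ℂ⟦X⟧ := fun z =>
  formalSum (fun n => ∑ α ∈ idx N n, ∑ β ∈ idx N n,
      ((β i : ℂ) * multiPow (Dhol G) α f z * multiPow (Dbar G) (β - unitIdx i) g z) • T n α β z)
  - PowerSeries.X * formalSum (fun n => ∑ α ∈ idx N n, ∑ β ∈ idx N n, ∑ d : Fin N,
      (G z d i * multiPow (Dhol G) (α + unitIdx d) f z * multiPow (Dbar G) β g z) • T n α β z)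
  + PowerSeries.X * formalSum (fun n => ∑ α ∈ idx N n, ∑ β ∈ idx N n,
      ∑ k : Fin N, ∑ p : Fin N,
      ((β k : ℂ) * ((β k : ℂ) - 1) / 2 * curvMixed G p k k i z
        * multiPow (Dhol G) α f z
        * multiPow (Dbar G) (β + unitIdx p - 2 • unitIdx k) g z) • T n α β z)
  + PowerSeries.X * formalSum (fun n => ∑ α ∈ idx N n, ∑ β ∈ idx N n,
      ∑ p : Fin N, ∑ k : Fin N, ∑ l ∈ Finset.Ioi k,
      ((β k : ℂ) * (β l : ℂ) * curvMixed G p l k i z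
        * multiPow (Dhol G) α f z
        * multiPow (Dbar G) (β + unitIdx p - unitIdx k - unitIdx l) g z) • T n α β z)

/-- The recurrence relations hold on `V`, for all indices `i` and all smooth `f`, `g` on `V`. -/
def SatisfiesRecurrence {N : ℕ} (G : Cn N → Matrix (Fin N) (Fin N) ℂ) (V : Set (Cn N))
    (T : Coeffs N) : Prop :=
  ∀ f g : Cn N → ℂ, ContDiffOn ℝ ∞ f V → ContDiffOn ℝ ∞ g V →
    ∀ i, ∀ z ∈ V, recurrence G T i f g z = 0

/-! ### Kähler manifolds -/

/-- Holomorphic coordinate charts of a complex manifold. -/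
abbrev holCharts (N : ℕ) (M : Type*) [TopologicalSpace M] [ChartedSpace (Cn N) M] :
    Set (OpenPartialHomeomorph M (Cn N)) :=
  IsManifold.maximalAtlas 𝓘(ℂ, Cn N) ω M

/-- Complex-valued functions that are smooth, in the real sense, on a set `V`. -/
abbrev SmoothOn (N : ℕ) {M : Type*} [TopologicalSpace M] [ChartedSpace (Cn N) M]
    (f : M → ℂ) (V : Set M) : Prop :=
  ContMDiffOn 𝓘(ℝ, Cn N) 𝓘(ℝ, ℂ) ∞ f V

/-- Components `g_{k l̄} = h(∂_k, ∂_l)`, in the chart `e`, of a field of sesquilinear forms `h` on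
the (holomorphic) tangent spaces. -/
def formCoord {N : ℕ} {M : Type*} [TopologicalSpace M] [ChartedSpace (Cn N) M]
    (h : ∀ p : M, TangentSpace 𝓘(ℂ, Cn N) p →ₗ[ℂ] TangentSpace 𝓘(ℂ, Cn N) p →ₗ⋆[ℂ] ℂ)
    (e : OpenPartialHomeomorph M (Cn N)) : Cn N → Matrix (Fin N) (Fin N) ℂ := fun z k l =>
  h (e.symm z) (mfderiv 𝓘(ℂ, Cn N) 𝓘(ℂ, Cn N) e.symm z (Pi.single k (1 : ℂ) : Cn N))
    (mfderiv 𝓘(ℂ, Cn N) 𝓘(ℂ, Cn N) e.symm z (Pi.single l (1 : ℂ) : Cn N))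

/-- A Kähler metric on a complex manifold: a field of positive definite Hermitian forms on the
tangent spaces that locally has a Kähler potential (so it is smooth, and its form is closed). -/
structure KahlerMetric (N : ℕ) (M : Type*) [TopologicalSpace M] [ChartedSpace (Cn N) M] where
  form : ∀ p : M, TangentSpace 𝓘(ℂ, Cn N) p →ₗ[ℂ] TangentSpace 𝓘(ℂ, Cn N) p →ₗ⋆[ℂ] ℂ
  hermitian : ∀ p v w, form p w v = star (form p v w)
  pos : ∀ p v, v ≠ 0 → 0 < (form p v v).re
  potential : ∀ e ∈ holCharts N M, ∀ z ∈ e.target, ∃ V : Set (Cn N), IsOpen V ∧ z ∈ V ∧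
    V ⊆ e.target ∧ ∃ Φ : Cn N → ℝ, IsPotential (formCoord form e) V Φ

variable {N : ℕ} {M : Type*} [TopologicalSpace M] [ChartedSpace (Cn N) M]

/-- The components `g_{k l̄}` of the metric in the chart `e`. -/
def KahlerMetric.coord (h : KahlerMetric N M) (e : OpenPartialHomeomorph M (Cn N)) :
    Cn N → Matrix (Fin N) (Fin N) ℂ := formCoord h.form e

/-- The curvature is covariantly constant, `∇ R = 0`. -/
def KahlerMetric.IsLocallySymmetric (h : KahlerMetric N M) : Prop :=
  ∀ e ∈ holCharts N M, IsParallel (h.coord e) e.target (curvTensor (h.coord e))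

/-! ### Star products

Bidifferential operators act on locally defined smooth functions. A function defined on an open
subset `V` of `M` is represented by any function on `M` that extends it, and only values at points
of `V` are used. -/

/-- `B` is a bidifferential operator: in every chart, locally, `B(f, g)` is a finite sum of terms
`a (∂^α ∂̄^{α'} f) (∂^β ∂̄^{β'} g)` with smooth functions `a`. -/
def IsBidifferential (N : ℕ) {M : Type*} [TopologicalSpace M] [ChartedSpace (Cn N) M]
    (B : (M → ℂ) → (M → ℂ) → M → ℂ) : Prop :=
  ∀ e ∈ holCharts N M, ∀ p ∈ e.source, ∃ W : Set M, IsOpen W ∧ p ∈ W ∧ W ⊆ e.source ∧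
    ∃ (r : ℕ) (a : (Fin N → ℕ) → (Fin N → ℕ) → (Fin N → ℕ) → (Fin N → ℕ) → M → ℂ),
      (∀ α α' β β', SmoothOn N (a α α' β β') W) ∧
      ∀ V : Set M, IsOpen V → V ⊆ W → ∀ f g : M → ℂ, SmoothOn N f V → SmoothOn N g V →
        ∀ q ∈ V, B f g q =
          ∑ α ∈ Finset.Iic (fun _ => r), ∑ α' ∈ Finset.Iic (fun _ => r),
          ∑ β ∈ Finset.Iic (fun _ => r), ∑ β' ∈ Finset.Iic (fun _ => r),
            a α α' β β' q
              * multiPow dz α (multiPow dzbar α' (f ∘ e.symm)) (e q)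
              * multiPow dz β (multiPow dzbar β' (g ∘ e.symm)) (e q)

/-- A star product `f * g = ∑_k C_k(f, g) ħ^k` on a Kähler manifold (deformation quantization);
products of formal power series are obtained by bilinear extension over `ℂ⟦ħ⟧`. The Poisson
bracket is normalized as `{f, g} = g^{k̄ l} (∂_{k̄} f ∂_l g - ∂_l f ∂_{k̄} g)`. -/
structure StarProduct (h : KahlerMetric N M) where
  C : ℕ → (M → ℂ) → (M → ℂ) → M → ℂ
  bidifferential : ∀ k, IsBidifferential N (C k)
  assoc : ∀ V : Set M, IsOpen V → ∀ f₁ f₂ f₃ : M → ℂ,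
    SmoothOn N f₁ V → SmoothOn N f₂ V → SmoothOn N f₃ V → ∀ m, ∀ p ∈ V,
      ∑ x ∈ Finset.HasAntidiagonal.antidiagonal m, C x.1 (C x.2 f₁ f₂) f₃ p =
        ∑ x ∈ Finset.HasAntidiagonal.antidiagonal m, C x.1 f₁ (C x.2 f₂ f₃) p
  zeroth : ∀ V : Set M, IsOpen V → ∀ f g : M → ℂ, SmoothOn N f V → SmoothOn N g V →
    ∀ p ∈ V, C 0 f g p = f p * g p
  first : ∀ V : Set M, IsOpen V → ∀ f g : M → ℂ, SmoothOn N f V → SmoothOn N g V →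
    ∀ e ∈ holCharts N M, ∀ p ∈ V ∩ e.source, C 1 f g p - C 1 g f p =
      ∑ k, ∑ l, (h.coord e (e p))⁻¹ k l *
        (dzbar k (f ∘ e.symm) (e p) * dz l (g ∘ e.symm) (e p)
          - dz l (f ∘ e.symm) (e p) * dzbar k (g ∘ e.symm) (e p))
  unit : ∀ V : Set M, IsOpen V → ∀ f : M → ℂ, SmoothOn N f V → ∀ k, ∀ p ∈ V,
    C k f (fun _ => 1) p = (if k = 0 then f p else 0) ∧
      C k (fun _ => 1) f p = (if k = 0 then f p else 0)

/-- The star product of two functions of the coordinates of the chart `e`. -/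
def StarProduct.coord {h : KahlerMetric N M} (S : StarProduct h)
    (e : OpenPartialHomeomorph M (Cn N)) (f g : Cn N → ℂ) : Cn N → ℂ⟦X⟧ := fun z =>
  PowerSeries.mk fun m => S.C m (f ∘ e) (g ∘ e) (e.symm z)

/-- Separation of variables: `a * f = a f` for holomorphic `a` and `f * b = f b` for
antiholomorphic `b`. -/
def StarProduct.SeparatesVariables {h : KahlerMetric N M} (S : StarProduct h) : Prop :=
  ∀ V : Set M, IsOpen V → ∀ f a : M → ℂ, SmoothOn N f V → SmoothOn N a V →
    (MDifferentiableOn 𝓘(ℂ, Cn N) 𝓘(ℂ, ℂ) a V →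
      ∀ k, ∀ p ∈ V, S.C k a f p = if k = 0 then a p * f p else 0) ∧
    (MDifferentiableOn 𝓘(ℂ, Cn N) 𝓘(ℂ, ℂ) (fun p => star (a p)) V →
      ∀ k, ∀ p ∈ V, S.C k f a p = if k = 0 then f p * a p else 0)

/-- Karabegov's condition, which singles out the star product with separation of variables that
is attached to the Kähler form itself: for every local Kähler potential `Φ` the operators
`L_f = f * ·` commute with `∂_{ī}Φ + ħ ∂_{ī}`. -/
def StarProduct.IsKarabegov {h : KahlerMetric N M} (S : StarProduct h) : Prop :=
  ∀ e ∈ holCharts N M, ∀ V : Set (Cn N), IsOpen V → V ⊆ e.target →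
    ∀ Φ : Cn N → ℝ, IsPotential (h.coord e) V Φ →
    ∀ f g : Cn N → ℂ, ContDiffOn ℝ ∞ f V → ContDiffOn ℝ ∞ g V →
    ∀ i, ∀ z ∈ V, commutator Φ i (S.coord e f) g z = 0

/-- In the chart `e` the star product is given by
`f * g = ∑_n ∑_{|α|=|β|=n} T^n_{αβ} (D^α f) (D^{β*} g)`. -/
def StarProduct.HasForm {h : KahlerMetric N M} (S : StarProduct h)
    (e : OpenPartialHomeomorph M (Cn N)) (T : Coeffs N) : Prop :=
  ∀ V : Set (Cn N), IsOpen V → V ⊆ e.target →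
    ∀ f g : Cn N → ℂ, ContDiffOn ℝ ∞ f V → ContDiffOn ℝ ∞ g V →
    ∀ z ∈ V, S.coord e f g z = starSum (h.coord e) T f g z

end KahlerStar

end

noncomputable section

namespace KahlerStar

open Finset

/-! ### Commuting derivations and their brackets, in an arbitrary commutative algebra. -/

section Algebra

/-! Everything rests on how `∂_ī` commutes with `D^{β*}`. Since the metric has a potential, the
`D^{j̄}` commute with each other (`contract_comm`). Differentiating the inverse metric gives
`[D^{j̄}, ∂_ī] = Γ_j^p D^{p̄}` with conjugate Christoffel symbols `Γ` (`contract_bracket`). A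
further `D^{c̄}` turns `Γ` into the mixed curvature (`contract_christoffel`), and the next one kills
it, because `∇R = 0` and all indices of the mixed curvature are antiholomorphic (`mixedCurv_const`).
So for a symbol `P` the bracket of `P(D)` with `∂_ī` stops after two terms, `Γ` times first and
`R/2` times second derivatives of `P` (`opEval_bracket`); on monomials the second derivatives give
the two curvature sums.

In `[L_f, ħ∂_ī]` the terms with `Γ` cancel against the derivatives of `T`, which is parallel
(`sum_parallel`). The derivative of `D^α f` gives the sum with `g_{d ī}`, since `∂_ī = g_{d ī} D^d`.
Finally `D^{j̄} ∂_īΦ = δ_{ij}`, so commuting with `∂_īΦ` lowers `β_i` by one (`opPow_mul_of_const`).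
Together this is `commutator_starSum`, and Karabegov's condition makes it zero.

For uniqueness, the functions `∂_īΦ` and `∂_iΦ`, shifted to vanish at a point, are coordinates dual
to the `D^{j̄}` and the `D^i`. Polynomials in them prescribe all `D^{β*} g` and `D^α f` at that
point, so the only sum without a factor `ħ` isolates `β_i T^n_{αβ}`. Every other sum contributes
lower powers of `ħ` of `T`, and induction on the power applies (`coeff_unique`). The start `T^0 = 1`
comes from the unit of the star product.

The calculus takes place in the algebra `SmoothFun V`, where differential operators are genuine
derivations; `Represents` carries the results back to functions on `ℂ^N`. -/

theorem List.ofFn_pow_add_single_prod {Mo : Type*} [Monoid Mo] :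
    ∀ {N : ℕ} (f : Fin N → Mo), (∀ i j, Commute (f i) (f j)) → ∀ (β : Fin N → ℕ) (j : Fin N),
      (List.ofFn fun k => f k ^ (β + unitIdx j) k).prod
        = f j * (List.ofFn fun k => f k ^ β k).prod := by
  intro N
  induction N with
  | zero => intro f _ β j; exact j.elim0
  | succ n ih =>
    intro f hf β j
    rw [List.ofFn_succ, List.ofFn_succ, List.prod_cons, List.prod_cons]
    refine Fin.cases ?_ (fun j => ?_) j
    · have h0 : ∀ k : Fin n, (β + unitIdx (0 : Fin (n + 1))) k.succ = β k.succ := by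
        intro k; simp [unitIdx]
      have h1 : (β + unitIdx (0 : Fin (n + 1))) (0 : Fin (n + 1)) = β 0 + 1 := by simp [unitIdx]
      simp only [h0, h1, pow_succ', mul_assoc]
    · have h0 : ∀ k : Fin n, (β + unitIdx j.succ) k.succ
          = ((fun k : Fin n => β k.succ) + unitIdx j) k := by
        intro k; simp [unitIdx, Pi.single_apply]
      have h1 : (β + unitIdx j.succ) (0 : Fin (n + 1)) = β 0 := by
        simp [unitIdx, (Fin.succ_ne_zero j).symm]
      simp only [h0, h1]
      rw [ih (fun k => f k.succ) (fun i j => hf _ _) (fun k => β k.succ) j, ← mul_assoc,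
        ← mul_assoc, ((hf 0 j.succ).pow_left (β 0)).eq]

variable {N : ℕ} {A : Type*} [CommRing A] [Algebra ℂ A]

/-- `D^β = D_1^{β_1} ⋯ D_N^{β_N}` as an operator on the algebra `A`. -/
def opPow (D : Fin N → Derivation ℂ A A) (β : Fin N → ℕ) : Module.End ℂ A :=
  (List.ofFn fun k => ((D k : A →ₗ[ℂ] A) : Module.End ℂ A) ^ β k).prod

theorem opPow_add_unitIdx {D : Fin N → Derivation ℂ A A}
    (hD : ∀ j k u, D j (D k u) = D k (D j u)) (β : Fin N → ℕ) (j : Fin N) (u : A) :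
    opPow D (β + unitIdx j) u = D j (opPow D β u) := by
  rw [opPow, List.ofFn_pow_add_single_prod]
  · rfl
  · intro i j
    exact LinearMap.ext fun u => hD i j u

theorem opPow_zero (D : Fin N → Derivation ℂ A A) (u : A) : opPow D 0 u = u := by
  simp [opPow, List.ofFn_const]

/-- `P(D) u` for a polynomial `P`. -/
def opEval (D : Fin N → Derivation ℂ A A) (u : A) : MvPolynomial (Fin N) ℂ →ₗ[ℂ] A :=
  (MvPolynomial.basisMonomials (Fin N) ℂ).constr ℂ fun β => opPow D β u

theorem opEval_monomial (D : Fin N → Derivation ℂ A A) (u : A) (β : Fin N →₀ ℕ) (c : ℂ) :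
    opEval D u (MvPolynomial.monomial β c) = c • opPow D β u := by
  have h : MvPolynomial.monomial β c
      = c • (MvPolynomial.basisMonomials (Fin N) ℂ) β := by
    simp [MvPolynomial.smul_monomial]
  rw [h, map_smul, opEval, Module.Basis.constr_basis]

theorem opEval_C (D : Fin N → Derivation ℂ A A) (u : A) (c : ℂ) :
    opEval D u (MvPolynomial.C c) = c • u := by
  rw [MvPolynomial.C_apply, opEval_monomial, Finsupp.coe_zero, opPow_zero]

/-- Reduces identities for `D^β` to inductions over polynomials, in which the multiplicities `β k`
appear as formal partial derivatives of the symbol. -/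
theorem opEval_mul_X {D : Fin N → Derivation ℂ A A}
    (hD : ∀ j k u, D j (D k u) = D k (D j u)) (u : A) (P : MvPolynomial (Fin N) ℂ) (j : Fin N) :
    opEval D u (P * MvPolynomial.X j) = D j (opEval D u P) := by
  induction P using MvPolynomial.induction_on' with
  | monomial β c =>
    rw [MvPolynomial.X, MvPolynomial.monomial_mul, opEval_monomial, opEval_monomial, mul_one,
      Derivation.map_smul, ← opPow_add_unitIdx hD]
    congr 3
    ext k
    simp [unitIdx, Finsupp.single_apply, Pi.single_apply, eq_comm]
  | add p q hp hq => rw [add_mul, map_add, hp, hq, map_add, map_add]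

/-- Commuting polynomials in the derivations `D_j` past a derivation `ε`, when the brackets
`[D_j, ε]` are combinations of the `D_p` whose coefficients are annihilated in two steps. -/
theorem opEval_bracket {D : Fin N → Derivation ℂ A A}
    (hD : ∀ j k u, D j (D k u) = D k (D j u)) (ε : Derivation ℂ A A)
    (Γ : Fin N → Fin N → A) (R : Fin N → Fin N → Fin N → A)
    (h1 : ∀ j u, D j (ε u) = ε (D j u) + ∑ p, Γ j p * D p u)
    (h2 : ∀ c d p, D c (Γ d p) = R p d c) (hR : ∀ p c d, R p c d = R p d c)
    (h3 : ∀ j p c d, D j (R p c d) = 0) (u : A) (P : MvPolynomial (Fin N) ℂ) :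
    opEval D (ε u) P = ε (opEval D u P)
      + ∑ k, ∑ p, Γ k p * D p (opEval D u (MvPolynomial.pderiv k P))
      + (1 / 2 : ℂ) • ∑ k, ∑ l, ∑ p, R p k l
          * D p (opEval D u (MvPolynomial.pderiv k (MvPolynomial.pderiv l P))) := by
  induction P using MvPolynomial.induction_on with
  | C c => simp [opEval_C]
  | add p q hp hq =>
    simp only [map_add, hp, hq, mul_add, sum_add_distrib, smul_add]
    ring
  | mul_X P j hP =>
    rw [opEval_mul_X hD, opEval_mul_X hD, hP]
    have e1 : ∀ (P : MvPolynomial (Fin N) ℂ) k, MvPolynomial.pderiv k (P * MvPolynomial.X j)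
        = MvPolynomial.pderiv k P * MvPolynomial.X j + if j = k then P else 0 := by
      intro P k
      rw [Derivation.leibniz, MvPolynomial.pderiv_X]
      by_cases hjk : j = k
      · subst hjk; simp; ring
      · simp [hjk, mul_comm]
    have e2 : ∀ k l, MvPolynomial.pderiv k (MvPolynomial.pderiv l (P * MvPolynomial.X j))
        = MvPolynomial.pderiv k (MvPolynomial.pderiv l P) * MvPolynomial.X j
          + (if j = k then MvPolynomial.pderiv l P else 0)
          + (if j = l then MvPolynomial.pderiv k P else 0) := by
      intro k l
      rw [e1, map_add, e1, apply_ite (MvPolynomial.pderiv k), map_zero]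
    simp only [e2]
    simp only [e1, map_add, map_sum, Derivation.leibniz, h1, opEval_mul_X hD, h2, h3, mul_add,
      sum_add_distrib, smul_eq_mul, mul_zero, add_zero, Derivation.map_smul, smul_add]
    have hc : ∀ p (v : A), D p (D j v) = D j (D p v) := fun p v => hD p j v
    simp only [hc, apply_ite (opEval D u), map_zero, apply_ite (D _), mul_ite, mul_zero, 
      sum_ite_eq, sum_ite_irrel, sum_const_zero, mem_univ, if_true]
    -- The second derivatives of `P * X j` contribute the cross term twice, with `R p j x` and with
    -- `R p x j`. By symmetry the two halves add up to the single term in which `D j` differentiates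
    -- `Γ`.
    have e3 : ∑ x, ∑ p, R p j x * D p (opEval D u (MvPolynomial.pderiv x P))
        = ∑ x, ∑ p, D p (opEval D u (MvPolynomial.pderiv x P)) * R p x j :=
      sum_congr rfl fun x _ => sum_congr rfl fun p _ => by rw [hR, mul_comm]
    have e4 : ∑ x, ∑ p, R p x j * D p (opEval D u (MvPolynomial.pderiv x P))
        = ∑ x, ∑ p, D p (opEval D u (MvPolynomial.pderiv x P)) * R p x j :=
      sum_congr rfl fun x _ => sum_congr rfl fun p _ => mul_comm _ _
    have e5 : ∀ v : A, (1 / 2 : ℂ) • v + (1 / 2 : ℂ) • v = v := fun v => by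
      rw [← add_smul]; norm_num
    rw [e3, e4, add_assoc ((1 / 2 : ℂ) • _), e5]
    ring

/-- The second-order part of the bracket on a monomial, sorted by pairs of indices. -/
theorem sum_opEval_pderiv_pderiv (D : Fin N → Derivation ℂ A A)
    (hD : ∀ j k u, D j (D k u) = D k (D j u))
    (R : Fin N → Fin N → Fin N → A) (hR : ∀ p c d, R p c d = R p d c) (u : A)
    (β : Fin N → ℕ) :
    (1 / 2 : ℂ) • ∑ k, ∑ l, ∑ p, R p k l * D p (opEval D u (MvPolynomial.pderiv k
        (MvPolynomial.pderiv l (MvPolynomial.monomial (Finsupp.equivFunOnFinite.symm β) 1))))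
      = ∑ k, ∑ p, ((β k : ℂ) * ((β k : ℂ) - 1) / 2)
            • (R p k k * opPow D (β + unitIdx p - 2 • unitIdx k) u)
        + ∑ p, ∑ k, ∑ l ∈ Ioi k, ((β k : ℂ) * (β l : ℂ))
            • (R p l k * opPow D (β + unitIdx p - unitIdx k - unitIdx l) u) := by
  set F : Fin N → Fin N → A := fun k l => ∑ p, R p k l * D p (opEval D u (MvPolynomial.pderiv k
        (MvPolynomial.pderiv l (MvPolynomial.monomial (Finsupp.equivFunOnFinite.symm β) 1))))
    with hF
  have hdiag : ∀ k, (1 / 2 : ℂ) • F k k = ∑ p, ((β k : ℂ) * ((β k : ℂ) - 1) / 2)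
      • (R p k k * opPow D (β + unitIdx p - 2 • unitIdx k) u) := by
    intro k
    rw [hF, smul_sum]
    refine sum_congr rfl fun p _ => ?_
    rw [MvPolynomial.pderiv_monomial, MvPolynomial.pderiv_monomial, opEval_monomial,
      Derivation.map_smul, mul_smul_comm, smul_smul, ← opPow_add_unitIdx hD]
    -- Subtraction of multi-indices is truncated. For `β k < 2` the coefficient vanishes, so the
    -- index is irrelevant; otherwise the order of adding and subtracting does not matter.
    rcases Nat.lt_or_ge (β k) 2 with h | h
    · have h' : β k = 0 ∨ β k = 1 := by omega
      rcases h' with h' | h' <;> simp [h']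
    · have e : (⇑(Finsupp.equivFunOnFinite.symm β - Finsupp.single k 1 - Finsupp.single k 1 : Fin N →₀ ℕ)
          + unitIdx p : Fin N → ℕ) = β + unitIdx p - 2 • unitIdx k := by
        ext x
        by_cases hx : x = k
        · subst hx
          simp [unitIdx]; omega
        · simp [unitIdx, hx]
      rw [e]
      congr 1
      have : ((β k - 1 : ℕ) : ℂ) = (β k : ℂ) - 1 := by
        rw [Nat.cast_sub (by omega)]; simp
      simp [this]; ring
  have hoff : ∀ k l, k ≠ l → F k l = ∑ p, ((β k : ℂ) * (β l : ℂ))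
      • (R p l k * opPow D (β + unitIdx p - unitIdx k - unitIdx l) u) := by
    intro k l hkl
    refine sum_congr rfl fun p _ => ?_
    rw [MvPolynomial.pderiv_monomial, MvPolynomial.pderiv_monomial, opEval_monomial,
      Derivation.map_smul, mul_smul_comm, ← opPow_add_unitIdx hD, hR]
    by_cases h1 : β k = 0
    · simp [h1]
    by_cases h2 : β l = 0
    · simp [h2]
    have e : (⇑(Finsupp.equivFunOnFinite.symm β - Finsupp.single l 1 - Finsupp.single k 1 : Fin N →₀ ℕ)
          + unitIdx p : Fin N → ℕ) = β + unitIdx p - unitIdx k - unitIdx l := by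
      ext x
      by_cases hx : x = k
      · subst hx
        simp [unitIdx, hkl]; omega
      · by_cases hx' : x = l
        · subst hx'
          simp [unitIdx, hx]; omega
        · simp [unitIdx, hx, hx']
    rw [e]
    congr 1
    simp [hkl]; ring
  have hsym : ∀ k l, k ≠ l → F k l = F l k := by
    intro k l hkl
    rw [hoff k l hkl, hoff l k hkl.symm]
    refine sum_congr rfl fun p _ => ?_
    rw [mul_comm (β k : ℂ), hR, tsub_right_comm]
  -- Each unordered pair `k ≠ l` occurs twice, which absorbs the factor `1 / 2`; the diagonal keeps
  -- it.
  have hsplit : ∑ k, ∑ l, F k l = ∑ k, F k k + ∑ k, ∑ l ∈ Ioi k, (F l k + F k l) := by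
    rw [sum_sum_Ioi_add_eq_sum_sum_off_diag, ← sum_add_distrib, sum_comm]
    refine sum_congr rfl fun k _ => ?_
    rw [← Finset.sum_add_sum_compl {k}, sum_singleton]
  rw [hsplit, smul_add, smul_sum]
  simp only [hdiag]
  congr 1
  rw [smul_sum, sum_comm' (t' := univ) (s' := fun _ => univ) (by simp)]
  refine sum_congr rfl fun k _ => ?_
  rw [smul_sum, sum_comm]
  refine sum_congr rfl fun l hl => ?_
  have hkl : k ≠ l := ne_of_lt (mem_Ioi.1 hl)
  rw [hsym l k hkl.symm, ← hoff k l hkl, ← two_smul ℂ, smul_smul]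
  norm_num

/-- The first-order part of the bracket on a monomial. -/
theorem sum_opEval_pderiv (D : Fin N → Derivation ℂ A A)
    (hD : ∀ j k u, D j (D k u) = D k (D j u)) (Γ : Fin N → Fin N → A) (u : A)
    (β : Fin N → ℕ) :
    ∑ k, ∑ p, Γ k p * D p (opEval D u (MvPolynomial.pderiv k
        (MvPolynomial.monomial (Finsupp.equivFunOnFinite.symm β) 1)))
      = ∑ k, ∑ p, (β k : ℂ) • (Γ k p * opPow D (β - unitIdx k + unitIdx p) u) := by
  refine sum_congr rfl fun k _ => sum_congr rfl fun p _ => ?_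
  rw [MvPolynomial.pderiv_monomial, opEval_monomial,
    Derivation.map_smul, mul_smul_comm, ← opPow_add_unitIdx hD]
  congr 1
  · simp
  · congr 3
    ext x
    simp [unitIdx, Finsupp.single_apply, Pi.single_apply, eq_comm]

/-- The bracket of `D^β` with a derivation `ε`. -/
theorem opPow_bracket {D : Fin N → Derivation ℂ A A}
    (hD : ∀ j k u, D j (D k u) = D k (D j u)) (ε : Derivation ℂ A A)
    (Γ : Fin N → Fin N → A) (R : Fin N → Fin N → Fin N → A)
    (h1 : ∀ j u, D j (ε u) = ε (D j u) + ∑ p, Γ j p * D p u)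
    (h2 : ∀ c d p, D c (Γ d p) = R p d c) (hR : ∀ p c d, R p c d = R p d c)
    (h3 : ∀ j p c d, D j (R p c d) = 0) (u : A) (β : Fin N → ℕ) :
    opPow D β (ε u) = ε (opPow D β u)
      + ∑ k, ∑ p, (β k : ℂ) • (Γ k p * opPow D (β - unitIdx k + unitIdx p) u)
      + (∑ k, ∑ p, ((β k : ℂ) * ((β k : ℂ) - 1) / 2)
            • (R p k k * opPow D (β + unitIdx p - 2 • unitIdx k) u)
        + ∑ p, ∑ k, ∑ l ∈ Ioi k, ((β k : ℂ) * (β l : ℂ))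
            • (R p l k * opPow D (β + unitIdx p - unitIdx k - unitIdx l) u)) := by
  rw [← sum_opEval_pderiv D hD, ← sum_opEval_pderiv_pderiv D hD R hR]
  have h := opEval_bracket hD ε Γ R h1 h2 hR h3 u
    (MvPolynomial.monomial (Finsupp.equivFunOnFinite.symm β) 1)
  simpa only [opEval_monomial, one_smul, Finsupp.coe_equivFunOnFinite_symm] using h

/-- `D^β (φ u) = φ D^β u + ∑ β_i c_i D^{β - e_i} u` when the `D_j φ = c_j` are constants. -/
theorem opPow_mul_of_const {D : Fin N → Derivation ℂ A A}
    (hD : ∀ j k u, D j (D k u) = D k (D j u)) (i : Fin N) (φ : A)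
    (hφ : ∀ j, D j φ = if j = i then 1 else 0) (u : A) (β : Fin N → ℕ) :
    opPow D β (φ * u) = φ * opPow D β u + (β i : ℂ) • opPow D (β - unitIdx i) u := by
  have key : ∀ P : MvPolynomial (Fin N) ℂ,
      opEval D (φ * u) P = φ * opEval D u P + opEval D u (MvPolynomial.pderiv i P) := by
    intro P
    induction P using MvPolynomial.induction_on with
    | C c => simp [opEval_C]
    | add p q hp hq => simp only [map_add, hp, hq]; ring
    | mul_X P j hP =>
      rw [opEval_mul_X hD, hP, opEval_mul_X hD, map_add, Derivation.leibniz, hφ,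
        Derivation.leibniz, map_add, MvPolynomial.pderiv_X, smul_eq_mul (a := MvPolynomial.X j),
        mul_comm (MvPolynomial.X j), opEval_mul_X hD]
      by_cases hji : j = i
      · subst hji; simp; ring
      · simp [hji]
  have h := key (MvPolynomial.monomial (Finsupp.equivFunOnFinite.symm β) 1)
  rw [MvPolynomial.pderiv_monomial] at h
  simp only [opEval_monomial, one_smul, Finsupp.coe_equivFunOnFinite_symm, one_mul] at h
  rw [h]
  congr 3
  congr 1
  ext x
  simp [unitIdx, Finsupp.single_apply, Pi.single_apply, eq_comm]

end Algebra

/-! ### Kähler identities for a matrix with entries in an algebra with derivations. -/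

section Metric

variable {N : ℕ} {A : Type*} [CommRing A] [Algebra ℂ A]
  {g h : Matrix (Fin N) (Fin N) A} {δ : Fin N → Derivation ℂ A A} {ε : Derivation ℂ A A}

theorem Matrix.map_derivation_mul (d : Derivation ℂ A A) (a b : Matrix (Fin N) (Fin N) A) :
    (a * b).map d = a.map d * b + a * b.map d := by
  ext i j
  simp only [Matrix.map_apply, Matrix.mul_apply, Matrix.add_apply, map_sum, Derivation.leibniz,
    smul_eq_mul, ← sum_add_distrib]
  exact sum_congr rfl fun x _ => by ring

theorem Matrix.map_derivation_inv (d : Derivation ℂ A A) (hg : h * g = 1) :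
    h.map d = - (h * g.map d * h) := by
  have h1 : (h * g).map d = 0 := by
    rw [hg]; ext i j
    by_cases hij : i = j <;> simp [hij]
  rw [Matrix.map_derivation_mul] at h1
  calc h.map d = h.map d * g * h := by rw [mul_assoc, mul_eq_one_comm.1 hg, mul_one]
    _ = _ := by rw [eq_neg_of_add_eq_zero_left h1, neg_mul]

/-- The derivations `∑_l h_{jl} δ_l`. -/
def contract (h : Matrix (Fin N) (Fin N) A) (δ : Fin N → Derivation ℂ A A) (j : Fin N) :
    Derivation ℂ A A := ∑ l, h j l • δ l

theorem contract_apply (j : Fin N) (u : A) : contract h δ j u = ∑ l, h j l * δ l u := by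
  change Derivation.coeFnAddMonoidHom (∑ l, h j l • δ l) u = _
  rw [map_sum, Finset.sum_apply]
  rfl

/-- With `δ h = - h (δ g) h` inserted, exchanging `j` and `k` amounts to exchanging `a` and `b` in
`δ a (g b c)`, which is symmetric by the Kähler condition `hK`. -/
theorem contract_comm (hg : h * g = 1) (hδ : ∀ j k u, δ j (δ k u) = δ k (δ j u))
    (hK : ∀ a b c, δ a (g b c) = δ b (g a c)) (j k : Fin N) (u : A) :
    contract h δ j (contract h δ k u) = contract h δ k (contract h δ j u) := by
  have e : ∀ j k, contract h δ j (contract h δ k u)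
      = (∑ a, ∑ l, h j a * h k l * δ a (δ l u))
        - ∑ a, ∑ b, h j a * h k b * ∑ l, ((g.map (δ a)) * h) b l * δ l u := by
    intro j k
    have e0 : ∀ a l, δ a (h k l) = - ∑ b, h k b * (g.map (δ a) * h) b l := by
      intro a l
      rw [← Matrix.mul_apply, ← mul_assoc, ← Matrix.neg_apply,
        ← Matrix.map_derivation_inv (δ a) hg, Matrix.map_apply]
    simp only [contract_apply, map_sum, Derivation.leibniz, smul_eq_mul, e0,
      sum_add_distrib, mul_neg, sum_neg_distrib, mul_sum, ← mul_assoc]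
    rw [sub_eq_add_neg]
    congr 1
    · rw [sum_comm]
      exact sum_congr rfl fun a _ => sum_congr rfl fun l _ => by ring
    · congr 1
      rw [sum_comm]
      refine sum_congr rfl fun a _ => ?_
      rw [sum_comm]
      exact sum_congr rfl fun b _ => sum_congr rfl fun l _ => by ring
  rw [e, e]
  congr 1
  · rw [sum_comm]
    exact sum_congr rfl fun b _ => sum_congr rfl fun l _ => by rw [hδ, mul_comm (h _ _)]
  · rw [sum_comm]
    refine sum_congr rfl fun b _ => sum_congr rfl fun l _ => ?_
    simp only [Matrix.mul_apply, Matrix.map_apply]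
    rw [mul_comm (h _ _)]
    simp only [hK b l]

/-- Only the coefficients `h j l` fail to commute with `ε`. Their derivative is `-(h * ε g) * h`,
whose last factor rebuilds the contracted derivations. -/
theorem contract_bracket (hg : h * g = 1) (hε : ∀ j u, δ j (ε u) = ε (δ j u)) (j : Fin N)
    (u : A) : contract h δ j (ε u)
      = ε (contract h δ j u) + ∑ p, (h * g.map ε) j p * contract h δ p u := by
  have e0 : ∀ l, ε (h j l) = - ∑ p, (h * g.map ε) j p * h p l := by
    intro l
    rw [← Matrix.mul_apply, ← Matrix.neg_apply, ← Matrix.map_derivation_inv ε hg,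
      Matrix.map_apply]
  simp only [contract_apply, map_sum, Derivation.leibniz, smul_eq_mul, e0, hε, sum_add_distrib,
    mul_neg, sum_neg_distrib, mul_sum, ← mul_assoc]
  have e1 : ∑ l, ∑ p, δ l u * (h * g.map ε) j p * h p l
      = ∑ p, ∑ l, (h * g.map ε) j p * h p l * δ l u := by
    rw [sum_comm]
    exact sum_congr rfl fun p _ => sum_congr rfl fun l _ => by ring
  rw [e1]
  ring

/-- `-R_{P ā Q b̄}` as an expression in the metric and its derivatives. -/
def negCurv (g h : Matrix (Fin N) (Fin N) A) (δ : Fin N → Derivation ℂ A A)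
    (ε : Derivation ℂ A A) (a : Fin N) : Matrix (Fin N) (Fin N) A := fun P Q =>
  δ Q (ε (g P a)) - (g.map (δ Q) * h * g.map ε) P a

/-- The mixed curvature `R_{ā}^{c̄ d̄}_{b̄}`. -/
def mixedCurv (g h : Matrix (Fin N) (Fin N) A) (δ : Fin N → Derivation ℂ A A)
    (ε : Derivation ℂ A A) (a c d : Fin N) : A :=
  (h * negCurv g h δ ε a * h.transpose) c d

theorem negCurv_transpose (hδ : ∀ j u, δ j (ε u) = ε (δ j u))
    (hK : ∀ a b c, δ a (g b c) = δ b (g a c)) (a : Fin N) :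
    (negCurv g h δ ε a).transpose = negCurv g h δ ε a := by
  ext P Q
  simp only [Matrix.transpose_apply, negCurv, hδ, hK P Q, Matrix.mul_apply, Matrix.map_apply]

theorem mixedCurv_symm (hδ : ∀ j u, δ j (ε u) = ε (δ j u))
    (hK : ∀ a b c, δ a (g b c) = δ b (g a c)) (a c d : Fin N) :
    mixedCurv g h δ ε a c d = mixedCurv g h δ ε a d c := by
  rw [mixedCurv, mixedCurv, ← Matrix.transpose_apply (h * _ * _) c d, Matrix.transpose_mul,
    Matrix.transpose_mul, Matrix.transpose_transpose, negCurv_transpose hδ hK, mul_assoc]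

/-- In the derivative of `h * ε g`, differentiating `h` produces exactly the quadratic term of the
curvature, and the factor `h` raises one index; the contraction raises the other. -/
theorem contract_christoffel (hg : h * g = 1) (c d a : Fin N) :
    contract h δ c ((h * g.map ε) d a) = mixedCurv g h δ ε a d c := by
  have e : ∀ Q, δ Q ((h * g.map ε) d a) = ∑ P, h d P * negCurv g h δ ε a P Q := by
    intro Q
    have : (h * g.map ε).map (δ Q)
        = h * ((g.map ε).map (δ Q) - g.map (δ Q) * h * g.map ε) := by
      rw [Matrix.map_derivation_mul, Matrix.map_derivation_inv (δ Q) hg]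
      noncomm_ring
    rw [← Matrix.map_apply (f := δ Q), this, Matrix.mul_apply]
    rfl
  rw [contract_apply, mixedCurv, Matrix.mul_apply (N := h.transpose)]
  refine sum_congr rfl fun Q _ => ?_
  rw [e, ← Matrix.mul_apply, Matrix.transpose_apply, mul_comm]

/-- `hR` is the holomorphic half of `∇R = 0`, with Christoffel terms for the two holomorphic
indices. Raising both indices cancels these terms against the derivatives of the two inverse
metrics. -/
theorem mixedCurv_const (hg : h * g = 1) (a m : Fin N)
    (hR : ∀ P Q, δ m (negCurv g h δ ε a P Q)
      = ∑ s, (g.map (δ m) * h) P s * negCurv g h δ ε a s Q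
        + ∑ s, (g.map (δ m) * h) Q s * negCurv g h δ ε a P s) (c d : Fin N) :
    δ m (mixedCurv g h δ ε a c d) = 0 := by
  set K := negCurv g h δ ε a
  have hK : K.map (δ m) = g.map (δ m) * h * K + K * (g.map (δ m) * h).transpose := by
    ext P Q
    simp only [Matrix.map_apply, hR, Matrix.add_apply, Matrix.mul_apply (M := _ * h),
      Matrix.mul_apply (M := K), Matrix.transpose_apply]
    congr 1
    exact sum_congr rfl fun s _ => mul_comm _ _
  have ht : h.transpose.map (δ m) = - (h.transpose * (g.map (δ m) ).transpose * h.transpose) := by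
    rw [Matrix.transpose_map, Matrix.map_derivation_inv (δ m) hg]
    simp [Matrix.transpose_mul, mul_assoc]
  have : (h * K * h.transpose).map (δ m) = 0 := by
    rw [Matrix.map_derivation_mul, Matrix.map_derivation_mul, hK, ht,
      Matrix.map_derivation_inv (δ m) hg, Matrix.transpose_mul]
    noncomm_ring
  exact congrFun (congrFun this c) d

end Metric

/-! ### Parallel symmetric tensors in multi-index notation. -/

section Symmetric

variable {N : ℕ} {A : Type*} [CommRing A] [Algebra ℂ A]

theorem mem_idx {n : ℕ} {β : Fin N → ℕ} : β ∈ idx N n ↔ ∑ k, β k = n := by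
  simp [idx]

theorem tsub_unitIdx_add_unitIdx {β : Fin N → ℕ} {k : Fin N} (h : β k ≠ 0) :
    β - unitIdx k + unitIdx k = β := by
  ext x
  by_cases hx : x = k
  · subst hx; simp [unitIdx]; omega
  · simp [unitIdx, hx]

theorem sum_add_unitIdx (β : Fin N → ℕ) (k : Fin N) :
    ∑ x, (β + unitIdx k) x = ∑ x, β x + 1 := by
  simp [unitIdx, sum_add_distrib]

theorem shift_mem_idx {n : ℕ} {β : Fin N → ℕ} {k : Fin N} (hβ : β ∈ idx N n) (h : β k ≠ 0)
    (s : Fin N) : β - unitIdx k + unitIdx s ∈ idx N n := by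
  rw [mem_idx] at *
  rw [sum_add_unitIdx, ← sum_add_unitIdx _ k, tsub_unitIdx_add_unitIdx h, hβ]

theorem sum_shift_idx {B : Type*} [AddCommMonoid B] (n : ℕ) (k s : Fin N)
    (F : (Fin N → ℕ) → (Fin N → ℕ) → B) :
    ∑ β ∈ (idx N n).filter (fun β => β k ≠ 0), F β (β - unitIdx k + unitIdx s)
      = ∑ β ∈ (idx N n).filter (fun β => β s ≠ 0), F (β - unitIdx s + unitIdx k) β := by
  have e : ∀ (β : Fin N → ℕ) (k s : Fin N), β k ≠ 0 →
      β - unitIdx k + unitIdx s - unitIdx s + unitIdx k = β := by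
    intro β k s h
    rw [add_tsub_cancel_right, tsub_unitIdx_add_unitIdx h]
  refine sum_nbij' (fun β => β - unitIdx k + unitIdx s) (fun β => β - unitIdx s + unitIdx k)
    ?_ ?_ ?_ ?_ ?_
  · intro β hβ
    rw [mem_filter] at hβ ⊢
    exact ⟨shift_mem_idx hβ.1 hβ.2 s, by simp [unitIdx]⟩
  · intro β hβ
    rw [mem_filter] at hβ ⊢
    exact ⟨shift_mem_idx hβ.1 hβ.2 k, by simp [unitIdx]⟩
  · intro β hβ
    exact e β k s (mem_filter.1 hβ).2
  · intro β hβ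
    exact e β s k (mem_filter.1 hβ).2
  · intro β hβ
    rw [e β k s (mem_filter.1 hβ).2]

theorem prod_factorial_add_unitIdx (γ : Fin N → ℕ) (s : Fin N) :
    ∏ k, ((γ + unitIdx s) k).factorial = (γ + unitIdx s) s * ∏ k, (γ k).factorial := by
  rw [← mul_prod_erase univ _ (mem_univ s), ← mul_prod_erase univ (fun k => (γ k).factorial)
    (mem_univ s), ← mul_assoc]
  congr 1
  · simp [unitIdx, Nat.factorial_succ]
  · refine prod_congr rfl fun k hk => ?_
    simp [unitIdx, (mem_erase.1 hk).1]

/-- Both factorial products are multiples of the one of `β - unitIdx k`, by `β k` and by the new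
entry at `s`. -/
theorem factorial_shift {β : Fin N → ℕ} {k : Fin N} (h : β k ≠ 0) (s : Fin N) :
    β k * ∏ x, ((β - unitIdx k + unitIdx s) x).factorial
      = (∏ x, (β x).factorial) * (β - unitIdx k + unitIdx s) s := by
  rw [prod_factorial_add_unitIdx]
  conv_rhs => rw [← tsub_unitIdx_add_unitIdx h, prod_factorial_add_unitIdx,
    tsub_unitIdx_add_unitIdx h]
  ring

/-- The derivatives of the components of a parallel symmetric tensor, contracted with arbitrary
symmetric components `Y`. -/
theorem sum_parallel (n : ℕ) (t dt Y : (Fin N → ℕ) → A) (Γ : Fin N → Fin N → A)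
    (ht : ∀ β ∈ idx N n, ((∏ x, (β x).factorial : ℕ) : ℂ) • dt β
      = ∑ k, ∑ s, ((β k : ℂ) * ((∏ x, ((β - unitIdx k + unitIdx s) x).factorial : ℕ) : ℂ))
          • (Γ s k * t (β - unitIdx k + unitIdx s))) :
    ∑ β ∈ idx N n, dt β * Y β
      = ∑ β ∈ idx N n, ∑ k, ∑ p, (β k : ℂ) • (t β * (Γ k p * Y (β - unitIdx k + unitIdx p))) := by
  -- Write `β'` for `β - e_k + e_s`. Dividing by `β!` turns the weight `β_k β'!` into `β'_s`, which
  -- is the multiplicity needed once `β'` becomes the summation index. The condition `β k ≠ 0`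
  -- excludes truncated subtraction.
  have h1 : ∀ β ∈ idx N n, dt β = ∑ k, ∑ s, if β k ≠ 0 then
      ((β - unitIdx k + unitIdx s) s : ℂ) • (Γ s k * t (β - unitIdx k + unitIdx s)) else 0 := by
    intro β hβ
    have hne : ((∏ x, (β x).factorial : ℕ) : ℂ) ≠ 0 :=
      Nat.cast_ne_zero.2 (prod_ne_zero_iff.2 fun x _ => Nat.factorial_ne_zero _)
    rw [← inv_smul_smul₀ hne (dt β), ht β hβ, smul_sum]
    refine sum_congr rfl fun k _ => ?_
    rw [smul_sum]
    refine sum_congr rfl fun s _ => ?_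
    by_cases hk : β k = 0
    · simp [hk]
    · rw [if_pos hk, ← Nat.cast_mul, factorial_shift hk, Nat.cast_mul, smul_smul,
        inv_mul_cancel_left₀ hne]
  have h2 : ∑ β ∈ idx N n, dt β * Y β
      = ∑ k, ∑ s, ∑ β ∈ idx N n, if β k ≠ 0 then
      ((β - unitIdx k + unitIdx s) s : ℂ) • (Γ s k * t (β - unitIdx k + unitIdx s)) * Y β
        else 0 := by
    rw [sum_congr rfl fun β hβ => by rw [h1 β hβ, sum_mul], sum_comm]
    refine sum_congr rfl fun k _ => ?_
    rw [sum_comm]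
    refine sum_congr rfl fun β hβ => ?_
    rw [sum_mul]
    exact sum_congr rfl fun s _ => by rw [ite_mul, zero_mul]
  have h3 : ∑ β ∈ idx N n, ∑ k, ∑ p,
        (β k : ℂ) • (t β * (Γ k p * Y (β - unitIdx k + unitIdx p)))
      = ∑ k, ∑ p, ∑ β ∈ idx N n, if β k ≠ 0 then
        (β k : ℂ) • (t β * (Γ k p * Y (β - unitIdx k + unitIdx p))) else 0 := by
    rw [sum_comm]
    refine sum_congr rfl fun k _ => ?_
    rw [sum_comm]
    refine sum_congr rfl fun p _ => sum_congr rfl fun β _ => ?_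
    by_cases hk : β k = 0 <;> simp [hk]
  rw [h2, h3, sum_comm]
  refine sum_congr rfl fun s _ => sum_congr rfl fun k _ => ?_
  -- Taking `β'` as the new summation index moves the shift from `t` to `Y` and exchanges the roles
  -- of `k` and `s`.
  rw [← sum_filter, ← sum_filter, sum_shift_idx n k s fun β β' =>
    ((β' s : ℂ) • (Γ s k * t β')) * Y β]
  refine sum_congr rfl fun β _ => ?_
  rw [smul_mul_assoc]
  congr 1
  ring

/-- The bracket of a derivation `ε` with the bidifferential operator of a parallel tensor. -/
theorem bidiff_bracket {D : Fin N → Derivation ℂ A A}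
    (hD : ∀ j k u, D j (D k u) = D k (D j u)) (ε : Derivation ℂ A A)
    (Γ : Fin N → Fin N → A) (R : Fin N → Fin N → Fin N → A)
    (h1 : ∀ j u, D j (ε u) = ε (D j u) + ∑ p, Γ j p * D p u)
    (h2 : ∀ c d p, D c (Γ d p) = R p d c) (hR : ∀ p c d, R p c d = R p d c)
    (h3 : ∀ j p c d, D j (R p c d) = 0) (X : (Fin N → ℕ) → A) (γ : Fin N → A)
    (hX : ∀ α, ε (X α) = ∑ d, γ d * X (α + unitIdx d)) (n : ℕ)
    (t : (Fin N → ℕ) → (Fin N → ℕ) → A)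
    (ht : ∀ α ∈ idx N n, ∀ β ∈ idx N n, ((∏ x, (β x).factorial : ℕ) : ℂ) • ε (t α β)
      = ∑ k, ∑ s, ((β k : ℂ) * ((∏ x, ((β - unitIdx k + unitIdx s) x).factorial : ℕ) : ℂ))
          • (Γ s k * t α (β - unitIdx k + unitIdx s))) (u : A) :
    ∑ α ∈ idx N n, ∑ β ∈ idx N n, t α β * X α * opPow D β (ε u)
        - ε (∑ α ∈ idx N n, ∑ β ∈ idx N n, t α β * X α * opPow D β u)
      = - (∑ α ∈ idx N n, ∑ β ∈ idx N n, ∑ d,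
            γ d * X (α + unitIdx d) * opPow D β u * t α β)
        + (∑ α ∈ idx N n, ∑ β ∈ idx N n, ∑ k, ∑ p, ((β k : ℂ) * ((β k : ℂ) - 1) / 2)
            • (R p k k * X α * opPow D (β + unitIdx p - 2 • unitIdx k) u * t α β))
        + ∑ α ∈ idx N n, ∑ β ∈ idx N n, ∑ p, ∑ k, ∑ l ∈ Ioi k, ((β k : ℂ) * (β l : ℂ))
            • (R p l k * X α * opPow D (β + unitIdx p - unitIdx k - unitIdx l) u * t α β) := by
  rw [map_sum, ← sum_sub_distrib, ← sum_neg_distrib, ← sum_add_distrib, ← sum_add_distrib]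
  refine sum_congr rfl fun α hα => ?_
  have e1 := sum_parallel n (t α) (fun β => ε (t α β)) (fun β => X α * opPow D β u) Γ (ht α hα)
  -- The first two groups, the derivative of `t` and the Christoffel terms, do not cancel for a
  -- single `β`; their sums over `β` do, by `e1`.
  have e2 : ∀ β, t α β * X α * opPow D β (ε u) - ε (t α β * X α * opPow D β u)
      = - (ε (t α β) * (X α * opPow D β u))
        + (∑ k, ∑ p, (β k : ℂ) • (t α β * (Γ k p * (X α
              * opPow D (β - unitIdx k + unitIdx p) u))))
        + (- (∑ d, γ d * X (α + unitIdx d) * opPow D β u * t α β)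
        + (∑ k, ∑ p, ((β k : ℂ) * ((β k : ℂ) - 1) / 2)
            • (R p k k * X α * opPow D (β + unitIdx p - 2 • unitIdx k) u * t α β))
        + ∑ p, ∑ k, ∑ l ∈ Ioi k, ((β k : ℂ) * (β l : ℂ))
            • (R p l k * X α * opPow D (β + unitIdx p - unitIdx k - unitIdx l) u * t α β)) := by
    intro β
    have m1 : ∀ (c : ℂ) (a b : A), c • (a * X α * b * t α β) = (t α β * X α) * c • (a * b) := by
      intro c a b
      rw [mul_smul_comm]; congr 1; ring
    have m2 : ∀ (c : ℂ) (a b : A), c • (t α β * (a * (X α * b))) = (t α β * X α) * c • (a * b) := by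
      intro c a b
      rw [mul_smul_comm]; congr 1; ring
    have m3 : ∑ d, γ d * X (α + unitIdx d) * opPow D β u * t α β
        = (∑ d, γ d * X (α + unitIdx d)) * (opPow D β u * t α β) := by
      rw [sum_mul]; exact sum_congr rfl fun d _ => by ring
    simp only [m1, m2, m3, ← mul_sum]
    rw [opPow_bracket hD ε Γ R h1 h2 hR h3, ← hX, Derivation.leibniz, Derivation.leibniz]
    simp only [smul_eq_mul]
    ring
  rw [map_sum, ← sum_sub_distrib, sum_congr rfl fun β _ => e2 β, sum_add_distrib,
    sum_add_distrib, sum_neg_distrib, e1, neg_add_cancel, zero_add, ← sum_neg_distrib,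
    ← sum_add_distrib, ← sum_add_distrib]

end Symmetric

/-! ### The algebra of smooth functions on an open set, with Wirtinger derivations. -/

section Smooth

variable {N : ℕ}

/-- The smooth functions on an open set, as a subalgebra of all functions. -/
def smoothSubalgebra (V : TopologicalSpace.Opens (Cn N)) : Subalgebra ℂ (V → ℂ) where
  carrier := {u | ∃ f : Cn N → ℂ, ContDiffOn ℝ ∞ f V ∧ ∀ x : V, u x = f x}
  mul_mem' := by
    rintro u v ⟨f, hf, hu⟩ ⟨g, hg, hv⟩
    exact ⟨fun x => f x * g x, hf.mul hg, fun x => by simp [hu, hv]⟩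
  add_mem' := by
    rintro u v ⟨f, hf, hu⟩ ⟨g, hg, hv⟩
    exact ⟨fun x => f x + g x, hf.add hg, fun x => by simp [hu, hv]⟩
  algebraMap_mem' c := ⟨fun _ => c, contDiffOn_const, fun _ => rfl⟩

/-- The algebra of smooth functions on an open set. -/
def SmoothFun (V : TopologicalSpace.Opens (Cn N)) : Type := smoothSubalgebra V

instance (V : TopologicalSpace.Opens (Cn N)) : CommRing (SmoothFun V) :=
  inferInstanceAs (CommRing (smoothSubalgebra V))

instance (V : TopologicalSpace.Opens (Cn N)) : Algebra ℂ (SmoothFun V) :=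
  inferInstanceAs (Algebra ℂ (smoothSubalgebra V))

variable {V : TopologicalSpace.Opens (Cn N)}

/-- Evaluation of smooth functions at a point. -/
def evalAt (x : V) : SmoothFun V →ₐ[ℂ] ℂ :=
  (Pi.evalAlgHom ℂ (fun _ : V => ℂ) x).comp (smoothSubalgebra V).val

theorem SmoothFun.ext {u v : SmoothFun V} (h : ∀ x, evalAt x u = evalAt x v) : u = v :=
  Subtype.ext (funext h)

/-- The function `f` on the coordinate space agrees on `V` with the element `u` of the algebra
of smooth functions on `V`. -/
def Represents (f : Cn N → ℂ) (u : SmoothFun V) : Prop := ∀ x : V, f x = evalAt x u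

theorem exists_represents (u : SmoothFun V) :
    ∃ f : Cn N → ℂ, ContDiffOn ℝ ∞ f V ∧ Represents f u := by
  obtain ⟨f, hf, hu⟩ := u.2
  exact ⟨f, hf, fun x => (hu x).symm⟩

theorem Represents.contDiffOn {f : Cn N → ℂ} {u : SmoothFun V} (h : Represents f u) :
    ContDiffOn ℝ ∞ f V := by
  obtain ⟨g, hg, hu⟩ := exists_represents u
  exact hg.congr fun x hx => (h ⟨x, hx⟩).trans (hu ⟨x, hx⟩).symm

/-- A function that is smooth on `V`, as an element of the algebra. -/
def ofContDiffOn (f : Cn N → ℂ) (hf : ContDiffOn ℝ ∞ f V) : SmoothFun V :=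
  ⟨fun x => f x, f, hf, fun _ => rfl⟩

theorem represents_ofContDiffOn (f : Cn N → ℂ) (hf : ContDiffOn ℝ ∞ f V) :
    Represents f (ofContDiffOn f hf) := fun _ => rfl

theorem Represents.congr {f g : Cn N → ℂ} {u : SmoothFun V} (h : Represents f u)
    (hfg : ∀ x ∈ V, g x = f x) : Represents g u := fun x => (hfg x x.2).trans (h x)

theorem Represents.unique {f : Cn N → ℂ} {u v : SmoothFun V} (h : Represents f u)
    (h' : Represents f v) : u = v := SmoothFun.ext fun x => (h x).symm.trans (h' x)

theorem Represents.eventuallyEq {f g : Cn N → ℂ} {u : SmoothFun V} (h : Represents f u)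
    (h' : Represents g u) (x : V) : f =ᶠ[𝓝 (x : Cn N)] g := by
  filter_upwards [V.isOpen.mem_nhds x.2] with y hy
  exact (h ⟨y, hy⟩).trans (h' ⟨y, hy⟩).symm

theorem Represents.contDiffAt {f : Cn N → ℂ} {u : SmoothFun V} (h : Represents f u) (x : V) :
    ContDiffAt ℝ ∞ f x := h.contDiffOn.contDiffAt (V.isOpen.mem_nhds x.2)

theorem Represents.differentiableAt {f : Cn N → ℂ} {u : SmoothFun V} (h : Represents f u)
    (x : V) : DifferentiableAt ℝ f x := (h.contDiffAt x).differentiableAt (by simp)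

theorem Represents.add {f g : Cn N → ℂ} {u v : SmoothFun V} (hf : Represents f u)
    (hg : Represents g v) : Represents (fun x => f x + g x) (u + v) := fun x => by
  simp only [map_add, hf x, hg x]

theorem Represents.mul {f g : Cn N → ℂ} {u v : SmoothFun V} (hf : Represents f u)
    (hg : Represents g v) : Represents (fun x => f x * g x) (u * v) := fun x => by
  simp only [map_mul, hf x, hg x]

theorem Represents.smul {f : Cn N → ℂ} {u : SmoothFun V} (c : ℂ) (hf : Represents f u) :
    Represents (fun x => c * f x) (c • u) := fun x => by
  simp only [map_smul, hf x, smul_eq_mul]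

theorem Represents.neg {f : Cn N → ℂ} {u : SmoothFun V} (hf : Represents f u) :
    Represents (fun x => - f x) (- u) := fun x => by
  simp only [map_neg, hf x]

theorem Represents.sum {ι : Type*} {s : Finset ι} {f : ι → Cn N → ℂ} {u : ι → SmoothFun V}
    (h : ∀ i ∈ s, Represents (f i) (u i)) :
    Represents (fun x => ∑ i ∈ s, f i x) (∑ i ∈ s, u i) := fun x => by
  rw [map_sum]
  exact sum_congr rfl fun i hi => h i hi x

/-- The derivative of a smooth function on `V` in the direction `v`. -/
def dirFun (v : Cn N) (u : SmoothFun V) : SmoothFun V :=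
  ofContDiffOn (fun x => fderiv ℝ (exists_represents u).choose x v)
    (((exists_represents u).choose_spec.1.fderiv_of_isOpen V.isOpen (by simp)).clm_apply
      contDiffOn_const)

/-- The derivative does not depend on the chosen extension, because two extensions agree near every
point of the open set `V`. -/
theorem Represents.dirFun {f : Cn N → ℂ} {u : SmoothFun V} (h : Represents f u) (v : Cn N) :
    Represents (fun x => fderiv ℝ f x v) (dirFun v u) :=
  (represents_ofContDiffOn _ _).congr fun x hx => by
    rw [(h.eventuallyEq (exists_represents u).choose_spec.2 ⟨x, hx⟩).fderiv_eq]

/-- Differentiation of smooth functions on `V` in the direction `v`. -/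
def dirDeriv (v : Cn N) : Derivation ℂ (SmoothFun V) (SmoothFun V) :=
  Derivation.mk'
    { toFun := dirFun v
      map_add' := fun a b => by
        obtain ⟨f, -, hf⟩ := exists_represents a
        obtain ⟨g, -, hg⟩ := exists_represents b
        refine ((hf.add hg).dirFun v).unique (((hf.dirFun v).add (hg.dirFun v)).congr
          fun x hx => ?_)
        rw [fderiv_fun_add (hf.differentiableAt ⟨x, hx⟩) (hg.differentiableAt ⟨x, hx⟩)]
        rfl
      map_smul' := fun c a => by
        obtain ⟨f, -, hf⟩ := exists_represents a
        refine ((hf.smul c).dirFun v).unique (((hf.dirFun v).smul c).congr fun x hx => ?_)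
        rw [fderiv_const_mul (hf.differentiableAt ⟨x, hx⟩)]
        rfl }
    fun a b => by
      obtain ⟨f, -, hf⟩ := exists_represents a
      obtain ⟨g, -, hg⟩ := exists_represents b
      refine ((hf.mul hg).dirFun v).unique (((hf.mul (hg.dirFun v)).add
        (hg.mul (hf.dirFun v))).congr fun x hx => ?_)
      rw [fderiv_fun_mul (hf.differentiableAt ⟨x, hx⟩) (hg.differentiableAt ⟨x, hx⟩)]
      rfl

theorem Represents.dirDeriv {f : Cn N → ℂ} {u : SmoothFun V} (h : Represents f u) (v : Cn N) :
    Represents (fun x => fderiv ℝ f x v) (dirDeriv v u) := h.dirFun v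

theorem dirDeriv_comm (v w : Cn N) (u : SmoothFun V) :
    dirDeriv v (dirDeriv w u) = dirDeriv w (dirDeriv v u) := by
  obtain ⟨f, -, hf⟩ := exists_represents u
  refine SmoothFun.ext fun x => ?_
  rw [← (hf.dirDeriv w).dirDeriv v x, ← (hf.dirDeriv v).dirDeriv w x]
  have hs := (hf.contDiffAt x).isSymmSndFDerivAt (by
    rw [minSmoothness_of_isRCLikeNormedField]
    exact WithTop.coe_le_coe.2 (le_top : (2 : ℕ∞) ≤ ⊤))
  have hd : DifferentiableAt ℝ (fderiv ℝ f) x :=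
    ((hf.contDiffAt x).fderiv_right (m := 1) (by norm_cast)).differentiableAt (by simp)
  simp only
  rw [fderiv_clm_apply hd (by fun_prop), fderiv_clm_apply hd (by fun_prop)]
  simpa using hs.eq v w

/-- `∂_k` as a derivation. -/
def derZ (k : Fin N) : Derivation ℂ (SmoothFun V) (SmoothFun V) :=
  (1 / 2 : ℂ) • (dirDeriv (V := V) (Pi.single k 1) - Complex.I • dirDeriv (V := V) (Pi.single k Complex.I))

/-- `∂_{k̄}` as a derivation. -/
def derZbar (k : Fin N) : Derivation ℂ (SmoothFun V) (SmoothFun V) :=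
  (1 / 2 : ℂ) • (dirDeriv (V := V) (Pi.single k 1) + Complex.I • dirDeriv (V := V) (Pi.single k Complex.I))

theorem Represents.dz {f : Cn N → ℂ} {u : SmoothFun V} (h : Represents f u) (k : Fin N) :
    Represents (dz k f) (derZ k u) := fun x => by
  have h1 := h.dirDeriv (Pi.single k 1) x
  have h2 := h.dirDeriv (Pi.single k Complex.I) x
  simp only at h1 h2
  simp [KahlerStar.dz, derZ, h1, h2]

theorem Represents.dzbar {f : Cn N → ℂ} {u : SmoothFun V} (h : Represents f u) (k : Fin N) :
    Represents (dzbar k f) (derZbar k u) := fun x => by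
  have h1 := h.dirDeriv (Pi.single k 1) x
  have h2 := h.dirDeriv (Pi.single k Complex.I) x
  simp only at h1 h2
  simp [KahlerStar.dzbar, derZbar, h1, h2, mul_add]

theorem derZ_comm (j k : Fin N) (u : SmoothFun V) :
    derZ j (derZ k u) = derZ k (derZ j u) := by
  simp only [derZ, Derivation.smul_apply, Derivation.sub_apply, map_sub, Derivation.map_smul,
    smul_sub, dirDeriv_comm (Pi.single j _)]
  module

theorem derZbar_comm (j k : Fin N) (u : SmoothFun V) :
    derZbar j (derZbar k u) = derZbar k (derZbar j u) := by
  simp only [derZbar, Derivation.smul_apply, Derivation.add_apply, map_add, Derivation.map_smul,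
    smul_add, dirDeriv_comm (Pi.single j _)]
  module

theorem derZ_derZbar (j k : Fin N) (u : SmoothFun V) :
    derZ j (derZbar k u) = derZbar k (derZ j u) := by
  simp only [derZ, derZbar, Derivation.smul_apply, Derivation.add_apply, Derivation.sub_apply,
    map_add, map_sub, Derivation.map_smul, smul_add, smul_sub, dirDeriv_comm (Pi.single j _)]
  module

/-- Applied to the determinant of the metric, this makes pointwise nondegeneracy into invertibility
of the matrix over `SmoothFun V`. -/
theorem isUnit_of_evalAt_ne_zero {u : SmoothFun V} (h : ∀ x, evalAt x u ≠ 0) : IsUnit u := by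
  obtain ⟨f, hf, hu⟩ := exists_represents u
  refine IsUnit.of_mul_eq_one (ofContDiffOn (fun x => (f x)⁻¹) (hf.inv fun x hx => ?_))
    (SmoothFun.ext fun x => ?_)
  · rw [hu ⟨x, hx⟩]; exact h _
  · rw [map_mul, map_one, ← hu, ← represents_ofContDiffOn]
    exact mul_inv_cancel₀ (by rw [hu]; exact h x)

/-- Operators on functions that are given on `V` by derivations have the same monomials. -/
theorem Represents.multiPow {B : Fin N → (Cn N → ℂ) → Cn N → ℂ}
    {D : Fin N → Derivation ℂ (SmoothFun V) (SmoothFun V)}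
    (hB : ∀ k f u, Represents f u → Represents (B k f) (D k u)) {f : Cn N → ℂ} {u : SmoothFun V}
    (h : Represents f u) (β : Fin N → ℕ) :
    Represents (multiPow B β f) (opPow D β u) := by
  have key : ∀ l : List (Fin N),
      Represents ((l.map fun k => (B k)^[β k]).foldr (fun A h => A h) f)
        ((l.map fun k => ((D k : SmoothFun V →ₗ[ℂ] SmoothFun V) :
          Module.End ℂ (SmoothFun V)) ^ β k).prod u) := by
    intro l
    induction l with
    | nil => simpa using h
    | cons k l ih =>
      simp only [List.map_cons, List.foldr_cons, List.prod_cons, Module.End.mul_apply]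
      induction β k with
      | zero => simpa using ih
      | succ n hn =>
        rw [Function.iterate_succ_apply', pow_succ', Module.End.mul_apply]
        exact hB k _ _ hn
  have := key (List.finRange N)
  rwa [← List.ofFn_eq_map, ← List.ofFn_eq_map] at this

end Smooth

/-! ### The metric of a potential: inverse, Christoffel symbols and curvature in `SmoothFun V`. -/

section Potential

variable {N : ℕ} {V : TopologicalSpace.Opens (Cn N)} {G : Cn N → Matrix (Fin N) (Fin N) ℂ}

theorem IsPotential.contDiffOn_ofReal {Φ : Cn N → ℝ} (hΦ : IsPotential G V Φ) :
    ContDiffOn ℝ ∞ (fun z => (Φ z : ℂ)) V :=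
  Complex.ofRealCLM.contDiff.comp_contDiffOn hΦ.1

/-- A Kähler potential as an element of the algebra of smooth functions. -/
def IsPotential.fn {Φ : Cn N → ℝ} (hΦ : IsPotential G V Φ) : SmoothFun V :=
  ofContDiffOn _ hΦ.contDiffOn_ofReal

/-- The matrix `∂_k ∂_{l̄} φ`. -/
def hess (φ : SmoothFun V) : Matrix (Fin N) (Fin N) (SmoothFun V) := fun k l =>
  derZ k (derZbar l φ)

theorem derZ_hess (φ : SmoothFun V) (a b c : Fin N) :
    derZ a (hess φ b c) = derZ b (hess φ a c) := derZ_comm _ _ _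

theorem derZbar_hess (φ : SmoothFun V) (a b c : Fin N) :
    derZbar a (hess φ b c) = derZbar c (hess φ b a) := by
  simp only [hess, derZ_derZbar, derZbar_comm a c]

/-- `φ` is a complex potential on `V` of a nondegenerate metric `G`. -/
structure RepresentsMetric (G : Cn N → Matrix (Fin N) (Fin N) ℂ) (φ : SmoothFun V) : Prop where
  metric : ∀ k l, Represents (fun z => G z k l) (hess φ k l)
  det_ne_zero : ∀ z ∈ V, (G z).det ≠ 0

theorem IsPotential.representsMetric {Φ : Cn N → ℝ} (hΦ : IsPotential G V Φ)
    (hG : ∀ z ∈ V, (G z).det ≠ 0) : RepresentsMetric G hΦ.fn where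
  metric k l := (((represents_ofContDiffOn _ hΦ.contDiffOn_ofReal).dzbar l).dz k).congr
    fun z hz => hΦ.2 z hz k l
  det_ne_zero := hG

namespace RepresentsMetric

variable {φ : SmoothFun V} (H : RepresentsMetric G φ)
include H

theorem map_evalAt (x : V) : (hess φ).map (evalAt x) = G x := by
  ext k l; exact (H.metric k l x).symm

theorem inv_mul : (hess φ)⁻¹ * hess φ = 1 := by
  refine Matrix.nonsing_inv_mul _ (isUnit_of_evalAt_ne_zero fun x => ?_)
  rw [AlgHom.map_det, AlgHom.mapMatrix_apply, H.map_evalAt]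
  exact H.det_ne_zero x x.2

theorem inv_map_evalAt (x : V) : ((hess φ)⁻¹).map (evalAt x) = (G x)⁻¹ := by
  symm
  apply Matrix.inv_eq_left_inv
  rw [← H.map_evalAt x]
  have := congrArg (fun M => (evalAt x).mapMatrix M) H.inv_mul
  simpa only [map_mul, map_one, AlgHom.mapMatrix_apply] using this

theorem inv_apply (k l : Fin N) : Represents (fun z => (G z)⁻¹ k l) ((hess φ)⁻¹ k l) := by
  intro x
  simp only [← H.inv_map_evalAt x, Matrix.map_apply]

theorem dbar {f : Cn N → ℂ} {u : SmoothFun V} (h : Represents f u) (j : Fin N) :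
    Represents (Dbar G j f) (contract (hess φ)⁻¹ derZ j u) := by
  rw [contract_apply]
  exact Represents.sum fun l _ => (H.inv_apply j l).mul (h.dz l)

theorem dhol {f : Cn N → ℂ} {u : SmoothFun V} (h : Represents f u) (k : Fin N) :
    Represents (Dhol G k f) (contract ((hess φ)⁻¹).transpose derZbar k u) := by
  rw [contract_apply]
  exact Represents.sum fun m _ => (H.inv_apply m k).mul (h.dzbar m)

theorem dbar_comm (j k : Fin N) (u : SmoothFun V) :
    contract (hess φ)⁻¹ derZ j (contract (hess φ)⁻¹ derZ k u)
      = contract (hess φ)⁻¹ derZ k (contract (hess φ)⁻¹ derZ j u) :=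
  contract_comm H.inv_mul derZ_comm (derZ_hess φ) j k u

theorem transpose_inv_mul : ((hess φ)⁻¹).transpose * (hess φ).transpose = 1 := by
  rw [← Matrix.transpose_mul, mul_eq_one_comm.1 H.inv_mul, Matrix.transpose_one]

theorem dhol_comm (j k : Fin N) (u : SmoothFun V) :
    contract ((hess φ)⁻¹).transpose derZbar j (contract ((hess φ)⁻¹).transpose derZbar k u)
      = contract ((hess φ)⁻¹).transpose derZbar k
        (contract ((hess φ)⁻¹).transpose derZbar j u) :=
  contract_comm H.transpose_inv_mul derZbar_comm
    (fun a b c => derZbar_hess φ a c b) j k u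

/-- An entry of `g⁻¹ g = 1`. It serves both the commutator with `∂_īΦ` and the construction of test
functions. -/
theorem dbar_potential (i j : Fin N) :
    contract (hess φ)⁻¹ derZ j (derZbar i φ) = if j = i then 1 else 0 := by
  have := congrFun (congrFun H.inv_mul j) i
  rw [Matrix.mul_apply, Matrix.one_apply] at this
  rw [contract_apply, ← this]
  rfl

theorem dhol_potential (i j : Fin N) :
    contract ((hess φ)⁻¹).transpose derZbar j (derZ i φ) = if j = i then 1 else 0 := by
  have := congrFun (congrFun H.transpose_inv_mul j) i
  rw [Matrix.mul_apply, Matrix.one_apply] at this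
  rw [contract_apply, ← this]
  exact sum_congr rfl fun m _ => by rw [Matrix.transpose_apply (hess φ), hess, derZ_derZbar]

/-- Lowering the index of `D^d` recovers `∂_ī`; this is how `∂_ī` acts on `D^α f` without leaving
the family of the `D^α f`. -/
theorem derZbar_eq (i : Fin N) (u : SmoothFun V) :
    derZbar i u = ∑ d, hess φ d i * contract ((hess φ)⁻¹).transpose derZbar d u := by
  have e : ∀ m, ∑ d, hess φ d i * (hess φ)⁻¹ m d = if m = i then 1 else 0 := by
    intro m
    have := congrFun (congrFun H.inv_mul m) i
    rw [Matrix.mul_apply, Matrix.one_apply] at this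
    rw [← this]
    exact sum_congr rfl fun d _ => mul_comm _ _
  simp only [contract_apply, mul_sum, Matrix.transpose_apply, ← mul_assoc]
  rw [sum_comm]
  simp only [← sum_mul, e]
  simp

/-- The Kähler symmetry exchanges the direction of differentiation with the holomorphic index of the
metric, which gives the matrix form used in the abstract identities. -/
theorem christoffel (s m k : Fin N) : Represents (christoffel G s m k)
    (((hess φ).map (derZ m) * (hess φ)⁻¹) k s) := by
  have e : ((hess φ).map (derZ m) * (hess φ)⁻¹) k s
      = ∑ q, (hess φ)⁻¹ q s * derZ k (hess φ m q) := by
    rw [Matrix.mul_apply]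
    exact sum_congr rfl fun q _ => by rw [Matrix.map_apply, derZ_hess, mul_comm]
  rw [e]
  exact Represents.sum fun q _ => (H.inv_apply q s).mul ((H.metric m q).dz k)

theorem christoffelBar (s m k : Fin N) : Represents (christoffelBar G s m k)
    (((hess φ)⁻¹ * (hess φ).map (derZbar m)) s k) := by
  have e : ((hess φ)⁻¹ * (hess φ).map (derZbar m)) s k
      = ∑ q, (hess φ)⁻¹ s q * derZbar k (hess φ q m) := by
    rw [Matrix.mul_apply]
    exact sum_congr rfl fun q _ => by rw [Matrix.map_apply, derZbar_hess]
  rw [e]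
  exact Represents.sum fun q _ => (H.inv_apply s q).mul ((H.metric q m).dzbar k)

theorem curv (P a Q b : Fin N) : Represents (curv G P a Q b)
    (- negCurv (hess φ) (hess φ)⁻¹ derZ (derZbar b) a P Q) := by
  have e : - negCurv (hess φ) (hess φ)⁻¹ derZ (derZbar b) a P Q
      = - derZ Q (derZbar b (hess φ P a)) + ∑ p, ∑ q, (hess φ)⁻¹ q p * derZ Q (hess φ P q)
          * derZbar b (hess φ p a) := by
    rw [negCurv, neg_sub, sub_eq_neg_add, Matrix.mul_apply]
    congr 1
    refine sum_congr rfl fun p _ => ?_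
    rw [Matrix.mul_apply, sum_mul]
    refine sum_congr rfl fun q _ => ?_
    rw [Matrix.map_apply, Matrix.map_apply, mul_comm (derZ Q _)]
  rw [e]
  exact (((H.metric P a).dzbar b).dz Q).neg.add (Represents.sum fun p _ => Represents.sum
    fun q _ => ((H.inv_apply q p).mul ((H.metric P q).dz Q)).mul ((H.metric p a).dzbar b))

theorem curvMixed (a c d b : Fin N) : Represents (curvMixed G a c d b)
    (mixedCurv (hess φ) (hess φ)⁻¹ derZ (derZbar b) a c d) := by
  have e : mixedCurv (hess φ) (hess φ)⁻¹ derZ (derZbar b) a c d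
      = ∑ P, ∑ Q, (hess φ)⁻¹ c P * (hess φ)⁻¹ d Q
          * (- - negCurv (hess φ) (hess φ)⁻¹ derZ (derZbar b) a P Q) := by
    rw [mixedCurv, Matrix.mul_apply, sum_comm]
    refine sum_congr rfl fun Q _ => ?_
    rw [Matrix.mul_apply, sum_mul]
    refine sum_congr rfl fun P _ => ?_
    rw [Matrix.transpose_apply]
    ring
  rw [e]
  exact Represents.sum fun P _ => Represents.sum fun Q _ =>
    ((H.inv_apply c P).mul (H.inv_apply d Q)).mul (H.curv P a Q b).neg

theorem negCurv_parallel (hR : IsParallel G V (curvTensor G)) (m P a Q b : Fin N) :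
    derZ m (negCurv (hess φ) (hess φ)⁻¹ derZ (derZbar b) a P Q)
      = ∑ s, ((hess φ).map (derZ m) * (hess φ)⁻¹) P s
            * negCurv (hess φ) (hess φ)⁻¹ derZ (derZbar b) a s Q
        + ∑ s, ((hess φ).map (derZ m) * (hess φ)⁻¹) Q s
            * negCurv (hess φ) (hess φ)⁻¹ derZ (derZbar b) a P s := by
  refine SmoothFun.ext fun x => ?_
  have h := (hR m ![P, Q] ![a, b] x x.2).1
  have hc : ∀ (I J : Fin 2 → Fin N), curvTensor G I J
      = KahlerStar.curv G (I 0) (J 0) (I 1) (J 1) := fun _ _ => rfl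
  rw [nabla, Fin.sum_univ_two] at h
  simp only [hc, Matrix.cons_val_zero, Matrix.cons_val_one, Function.update_self,
    Function.update_of_ne (Fin.zero_ne_one (n := 0)).symm, Function.update_of_ne (Fin.zero_ne_one (n := 0)),
    ((H.curv P a Q b).dz m x), H.curv _ a _ b x, H.christoffel _ m _ x] at h
  simp only [map_neg, mul_neg, sum_neg_distrib] at h
  simp only [map_add, map_sum, map_mul]
  linear_combination -h

theorem mixedCurv_const (hR : IsParallel G V (curvTensor G)) (j a c d b : Fin N) :
    contract (hess φ)⁻¹ derZ j (mixedCurv (hess φ) (hess φ)⁻¹ derZ (derZbar b) a c d) = 0 := by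
  rw [contract_apply]
  refine sum_eq_zero fun m _ => ?_
  rw [KahlerStar.mixedCurv_const H.inv_mul a m (fun P Q => H.negCurv_parallel hR m P a Q b),
    mul_zero]

end RepresentsMetric

end Potential

/-! ### From index tuples to multi-indices. -/

section Indices

variable {N : ℕ}

theorem exists_countIdx {n : ℕ} {β : Fin N → ℕ} (hβ : β ∈ idx N n) :
    ∃ J : Fin n → Fin N, countIdx J = β := by
  rw [mem_idx] at hβ
  subst hβ
  -- The tuple consists of consecutive blocks, the value `k` being repeated `β k` times.
  refine ⟨fun q => (finSigmaFinEquiv.symm q).1, funext fun k => ?_⟩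
  rw [countIdx, card_filter, ← Equiv.sum_comp finSigmaFinEquiv]
  simp only [Equiv.symm_apply_apply]
  rw [Fintype.sum_sigma]
  simp [apply_ite Finset.card]

theorem sum_countIdx {n : ℕ} {B : Type*} [AddCommMonoid B] (J : Fin n → Fin N) (f : Fin N → B) :
    ∑ q, f (J q) = ∑ k, countIdx J k • f k := by
  rw [← Finset.sum_fiberwise_of_maps_to (s := univ) (t := univ) (g := J) (by simp)]
  refine sum_congr rfl fun k _ => ?_
  rw [sum_congr rfl fun q hq => by rw [(mem_filter.1 hq).2], sum_const, countIdx]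

theorem countIdx_mem_idx {n : ℕ} (J : Fin n → Fin N) : countIdx J ∈ idx N n := by
  have := sum_countIdx J fun _ => 1
  rw [mem_idx]
  simpa using this.symm

theorem countIdx_update {n : ℕ} (J : Fin n → Fin N) (q : Fin n) (s : Fin N) :
    countIdx (Function.update J q s) = countIdx J - unitIdx (J q) + unitIdx s := by
  ext k
  have e : ∀ I : Fin n → Fin N, countIdx I k
      = (if I q = k then 1 else 0) + ∑ x ∈ univ.erase q, if I x = k then 1 else 0 := by
    intro I
    rw [countIdx, card_filter]
    exact (add_sum_erase univ (fun x => if I x = k then 1 else 0) (mem_univ q)).symm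
  have e2 : ∑ x ∈ univ.erase q, (if Function.update J q s x = k then 1 else 0)
      = ∑ x ∈ univ.erase q, if J x = k then 1 else 0 :=
    sum_congr rfl fun x hx => by rw [Function.update_of_ne (mem_erase.1 hx).1]
  rw [e, e2, Function.update_self, Pi.add_apply, Pi.sub_apply, e J]
  have e3 : ∀ a : Fin N, unitIdx a k = if a = k then 1 else 0 := by
    intro a; simp [unitIdx, Pi.single_apply, eq_comm]
  rw [e3, e3, add_tsub_cancel_left, add_comm]

end Indices

/-! ### Coefficients of formal sums as finite sums. -/

section Series

theorem coeff_formalSum (F : ℕ → ℂ⟦X⟧) (m : ℕ) :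
    PowerSeries.coeff m (formalSum F) = ∑ᶠ n, PowerSeries.coeff m (F n) := by
  rw [formalSum, PowerSeries.coeff_mk]

theorem finsum_eq_sum_range {B : Type*} [AddCommMonoid B] {F : ℕ → B} {n₀ : ℕ}
    (h : ∀ n ≥ n₀, F n = 0) : ∑ᶠ n, F n = ∑ n ∈ range n₀, F n :=
  finsum_eq_sum_of_support_subset _ fun n hn => by
    rw [coe_range, Set.mem_Iio]
    by_contra hc
    exact hn (h n (not_lt.1 hc))

variable {N : ℕ}

/-- The coefficient of a formal sum of multiples of the `T^n_{αβ}` at a point. -/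
theorem coeff_formalSum_smul {T : Coeffs N} {z : Cn N} {m n₀ : ℕ}
    (h : ∀ n ≥ n₀, ∀ α ∈ idx N n, ∀ β ∈ idx N n, PowerSeries.coeff m (T n α β z) = 0)
    (c : ℕ → (Fin N → ℕ) → (Fin N → ℕ) → ℂ) :
    PowerSeries.coeff m (formalSum fun n => ∑ α ∈ idx N n, ∑ β ∈ idx N n, c n α β • T n α β z)
      = ∑ n ∈ range n₀, ∑ α ∈ idx N n, ∑ β ∈ idx N n,
          c n α β * PowerSeries.coeff m (T n α β z) := by
  rw [coeff_formalSum]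
  simp only [map_sum, PowerSeries.coeff_smul, smul_eq_mul]
  refine finsum_eq_sum_range fun n hn => ?_
  exact sum_eq_zero fun α hα => sum_eq_zero fun β hβ => by rw [h n hn α hα β hβ, mul_zero]

theorem IsCoeffFamily.exists_bound {U : Set (Cn N)} {T : Coeffs N} (hT : IsCoeffFamily U T)
    (m : ℕ) {z : Cn N} (hz : z ∈ U) : ∃ n₀, ∀ n ≥ n₀, ∀ α ∈ idx N n, ∀ β ∈ idx N n,
      PowerSeries.coeff m (T n α β z) = 0 := by
  obtain ⟨n₀, h⟩ := hT.locally_finite m z hz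
  exact ⟨n₀, h.self_of_nhds⟩

theorem IsCoeffFamily.mono {U U' : Set (Cn N)} {T : Coeffs N} (hT : IsCoeffFamily U T)
    (h : U' ⊆ U) : IsCoeffFamily U' T where
  smooth n α hα β hβ m := (hT.smooth n α hα β hβ m).mono h
  locally_finite m z hz := hT.locally_finite m z (h hz)

variable {V : TopologicalSpace.Opens (Cn N)}

/-- The coefficients of the `T^n_{αβ}` as elements of the algebra of smooth functions. -/
def IsCoeffFamily.fn {T : Coeffs N} (hT : IsCoeffFamily V T) (n m : ℕ) (α β : Fin N → ℕ) :
    SmoothFun V :=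
  open scoped Classical in
  -- Smoothness is assumed only for indices of degree `n`; the default `0` covers the others, over
  -- which no sum runs.
  if h : α ∈ idx N n ∧ β ∈ idx N n then
    ofContDiffOn _ (hT.smooth n α h.1 β h.2 m) else 0

theorem IsCoeffFamily.represents_fn {T : Coeffs N} (hT : IsCoeffFamily V T) {n : ℕ} (m : ℕ)
    {α β : Fin N → ℕ} (hα : α ∈ idx N n) (hβ : β ∈ idx N n) :
    Represents (fun z => PowerSeries.coeff m (T n α β z)) (hT.fn n m α β) := by
  rw [IsCoeffFamily.fn, dif_pos ⟨hα, hβ⟩]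
  exact represents_ofContDiffOn _ _

end Series

/-! ### The commutator formula. -/

section Commutator

variable {N : ℕ} {V : TopologicalSpace.Opens (Cn N)} {G : Cn N → Matrix (Fin N) (Fin N) ℂ}

namespace RepresentsMetric

variable {φ : SmoothFun V} (H : RepresentsMetric G φ)
include H

theorem represents_multiPow_dbar {f : Cn N → ℂ} {u : SmoothFun V} (h : Represents f u)
    (β : Fin N → ℕ) : Represents (multiPow (Dbar G) β f)
      (opPow (contract (hess φ)⁻¹ derZ) β u) :=
  Represents.multiPow (fun k _ _ hf => H.dbar hf k) h β

theorem represents_multiPow_dhol {f : Cn N → ℂ} {u : SmoothFun V} (h : Represents f u)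
    (β : Fin N → ℕ) : Represents (multiPow (Dhol G) β f)
      (opPow (contract ((hess φ)⁻¹).transpose derZbar) β u) :=
  Represents.multiPow (fun k _ _ hf => H.dhol hf k) h β

/-- Covariant constancy in terms of the coefficients with multi-indices. -/
theorem derZbar_coeff {T : Coeffs N} (hT : IsCoeffFamily V T)
    (hP : CovariantlyConstant G V T) (i : Fin N) (n m : ℕ) {α β : Fin N → ℕ}
    (hα : α ∈ idx N n) (hβ : β ∈ idx N n) :
    ((∏ x, (β x).factorial : ℕ) : ℂ) • derZbar i (hT.fn n m α β)
      = ∑ k, ∑ s, ((β k : ℂ) * ((∏ x, ((β - unitIdx k + unitIdx s) x).factorial : ℕ) : ℂ))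
          • (((hess φ)⁻¹ * (hess φ).map (derZbar i)) s k
              * hT.fn n m α (β - unitIdx k + unitIdx s)) := by
  obtain ⟨I, rfl⟩ := exists_countIdx hα
  obtain ⟨J, rfl⟩ := exists_countIdx hβ
  refine SmoothFun.ext fun x => ?_
  set a : ℂ := ((∏ k, (countIdx I k).factorial : ℕ) : ℂ) / (n.factorial : ℂ) with ha
  have hn : (n.factorial : ℂ) ≠ 0 := Nat.cast_ne_zero.2 (Nat.factorial_ne_zero n)
  have ha0 : a / n.factorial ≠ 0 :=
    div_ne_zero (div_ne_zero (Nat.cast_ne_zero.2 (prod_ne_zero_iff.2 fun x _ =>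
      Nat.factorial_ne_zero _)) hn) hn
  have hrep : ∀ K : Fin n → Fin N, Represents (coeffTensor T n m I K)
      ((a / n.factorial) • ((∏ k, (countIdx K k).factorial : ℕ) : ℂ)
        • hT.fn n m (countIdx I) (countIdx K)) := by
    intro K
    rw [smul_smul]
    refine ((hT.represents_fn m (countIdx_mem_idx I) (countIdx_mem_idx K)).smul _).congr
      fun z _ => ?_
    rw [coeffTensor, ← ha]
    ring
  have h := (hP n m i I J x x.2).2
  rw [nablaBar, (hrep J).dzbar i x] at h
  simp only [hrep _ x, H.christoffelBar _ i _ x, countIdx_update] at h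
  -- The Christoffel terms depend on a position `q` only through `J q`; grouping positions by this
  -- value creates the factor `β k`.
  rw [sum_countIdx J fun k => ∑ s, evalAt x (((hess φ)⁻¹ * (hess φ).map (derZbar i)) s k)
    * evalAt x ((a / n.factorial) • ((∏ x, ((countIdx J - unitIdx k + unitIdx s) x).factorial : ℕ)
      : ℂ) • hT.fn n m (countIdx I) (countIdx J - unitIdx k + unitIdx s))] at h
  rw [← sub_eq_zero]
  refine (mul_eq_zero.1 (Eq.trans ?_ h)).resolve_left ha0
  simp only [Derivation.map_smul, map_smul, map_sum, map_mul, smul_eq_mul, nsmul_eq_mul, mul_sub,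
    mul_sum]
  congr 1
  exact sum_congr rfl fun k _ => sum_congr rfl fun s _ => by ring

/-- The bracket with `∂_{ī}` of a bidifferential operator given by a parallel tensor. -/
theorem bidiff_bracket {T : Coeffs N} (hT : IsCoeffFamily V T) (hP : CovariantlyConstant G V T)
    (hR : IsParallel G V (curvTensor G)) (u v : SmoothFun V) (i : Fin N) (n m : ℕ) :
    ∑ α ∈ idx N n, ∑ β ∈ idx N n, hT.fn n m α β
          * opPow (contract ((hess φ)⁻¹).transpose derZbar) α u
          * opPow (contract (hess φ)⁻¹ derZ) β (derZbar i v)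
        - derZbar i (∑ α ∈ idx N n, ∑ β ∈ idx N n, hT.fn n m α β
          * opPow (contract ((hess φ)⁻¹).transpose derZbar) α u
          * opPow (contract (hess φ)⁻¹ derZ) β v)
      = - (∑ α ∈ idx N n, ∑ β ∈ idx N n, ∑ d, hess φ d i
            * opPow (contract ((hess φ)⁻¹).transpose derZbar) (α + unitIdx d) u
            * opPow (contract (hess φ)⁻¹ derZ) β v * hT.fn n m α β)
        + (∑ α ∈ idx N n, ∑ β ∈ idx N n, ∑ k, ∑ p, ((β k : ℂ) * ((β k : ℂ) - 1) / 2)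
            • (mixedCurv (hess φ) (hess φ)⁻¹ derZ (derZbar i) p k k
            * opPow (contract ((hess φ)⁻¹).transpose derZbar) α u
            * opPow (contract (hess φ)⁻¹ derZ) (β + unitIdx p - 2 • unitIdx k) v
            * hT.fn n m α β))
        + ∑ α ∈ idx N n, ∑ β ∈ idx N n, ∑ p, ∑ k, ∑ l ∈ Ioi k, ((β k : ℂ) * (β l : ℂ))
            • (mixedCurv (hess φ) (hess φ)⁻¹ derZ (derZbar i) p l k
            * opPow (contract ((hess φ)⁻¹).transpose derZbar) α u
            * opPow (contract (hess φ)⁻¹ derZ) (β + unitIdx p - unitIdx k - unitIdx l) v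
            * hT.fn n m α β) :=
  KahlerStar.bidiff_bracket H.dbar_comm (derZbar i) ((hess φ)⁻¹ * (hess φ).map (derZbar i))
    (fun p c d => mixedCurv (hess φ) (hess φ)⁻¹ derZ (derZbar i) p c d)
    (fun j u => contract_bracket H.inv_mul (fun j u => derZ_derZbar j i u) j u)
    (fun c d p => contract_christoffel H.inv_mul c d p)
    (fun p c d => mixedCurv_symm (fun j u => derZ_derZbar j i u) (derZ_hess φ) p c d)
    (fun j p c d => H.mixedCurv_const hR j p c d i)
    (fun α => opPow (contract ((hess φ)⁻¹).transpose derZbar) α u) (fun d => hess φ d i)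
    (fun α => by
      rw [H.derZbar_eq]
      exact sum_congr rfl fun d _ => by rw [opPow_add_unitIdx H.dhol_comm])
    n (hT.fn n m) (fun α hα β hβ => H.derZbar_coeff hT hP i n m hα hβ) v

theorem represents_term {T : Coeffs N} (hT : IsCoeffFamily V T) {f g : Cn N → ℂ}
    {u v : SmoothFun V} (hu : Represents f u) (hv : Represents g v) (n m : ℕ) :
    Represents (fun w => ∑ α ∈ idx N n, ∑ β ∈ idx N n, (multiPow (Dhol G) α f w
        * multiPow (Dbar G) β g w) * PowerSeries.coeff m (T n α β w))
      (∑ α ∈ idx N n, ∑ β ∈ idx N n, hT.fn n m α β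
        * opPow (contract ((hess φ)⁻¹).transpose derZbar) α u
        * opPow (contract (hess φ)⁻¹ derZ) β v) := by
  refine Represents.sum fun α hα => Represents.sum fun β hβ => ?_
  rw [mul_assoc, mul_comm (hT.fn n m α β)]
  exact ((H.represents_multiPow_dhol hu α).mul (H.represents_multiPow_dbar hv β)).mul
    (hT.represents_fn m hα hβ)

/-- The bracket with `∂_{ī}` of a term of `starSum`. -/
theorem term_bracket {T : Coeffs N} (hT : IsCoeffFamily V T) (hP : CovariantlyConstant G V T)
    (hR : IsParallel G V (curvTensor G)) {f g : Cn N → ℂ} {u v : SmoothFun V}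
    (hu : Represents f u) (hv : Represents g v) (i : Fin N) (n m : ℕ) (x : V) :
    (∑ α ∈ idx N n, ∑ β ∈ idx N n, (multiPow (Dhol G) α f x
        * multiPow (Dbar G) β (dzbar i g) x) * PowerSeries.coeff m (T n α β x))
      - dzbar i (fun w => ∑ α ∈ idx N n, ∑ β ∈ idx N n, (multiPow (Dhol G) α f w
        * multiPow (Dbar G) β g w) * PowerSeries.coeff m (T n α β w)) x
    = - (∑ α ∈ idx N n, ∑ β ∈ idx N n, (∑ d, G x d i * multiPow (Dhol G) (α + unitIdx d) f x
          * multiPow (Dbar G) β g x) * PowerSeries.coeff m (T n α β x))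
      + (∑ α ∈ idx N n, ∑ β ∈ idx N n, (∑ k, ∑ p, (β k : ℂ) * ((β k : ℂ) - 1) / 2
          * KahlerStar.curvMixed G p k k i x * multiPow (Dhol G) α f x
          * multiPow (Dbar G) (β + unitIdx p - 2 • unitIdx k) g x)
            * PowerSeries.coeff m (T n α β x))
      + ∑ α ∈ idx N n, ∑ β ∈ idx N n, (∑ p, ∑ k, ∑ l ∈ Ioi k, (β k : ℂ) * (β l : ℂ)
          * KahlerStar.curvMixed G p l k i x * multiPow (Dhol G) α f x
          * multiPow (Dbar G) (β + unitIdx p - unitIdx k - unitIdx l) g x)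
            * PowerSeries.coeff m (T n α β x) := by
  refine (congrArg₂ (· - ·) (H.represents_term hT hu (hv.dzbar i) n m x)
    ((H.represents_term hT hu hv n m).dzbar i x)).trans ?_
  rw [← map_sub, H.bidiff_bracket hT hP hR]
  have e1 := fun α => (H.represents_multiPow_dhol hu α x).symm
  have e2 := fun β => (H.represents_multiPow_dbar hv β x).symm
  have e3 := fun p c d => (H.curvMixed p c d i x).symm
  have e4 := fun d => (H.metric d i x).symm
  simp only [map_add, map_neg, map_sum, map_mul, map_smul, smul_eq_mul, e1, e2, e3, e4]
  refine congrArg₂ (· + ·) (congrArg₂ (· + ·) (congrArg Neg.neg ?_) ?_) ?_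
  all_goals
    refine sum_congr rfl fun α hα => sum_congr rfl fun β hβ => ?_
    have e5 : evalAt x (hT.fn n m α β) = PowerSeries.coeff m (T n α β x) :=
      (hT.represents_fn m hα hβ x).symm
    simp only [e5, sum_mul, mul_assoc]

/-- Moving `∂_{ī}Φ` past a term of `starSum`. -/
theorem term_potential {Φ g : Cn N → ℂ} (hΦ : Represents Φ φ)
    (hg : ContDiffOn ℝ ∞ g V) (i : Fin N) (n : ℕ) (c : (Fin N → ℕ) → ℂ)
    (τ : (Fin N → ℕ) → (Fin N → ℕ) → ℂ) {z : Cn N} (hz : z ∈ V) :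
    (∑ α ∈ idx N n, ∑ β ∈ idx N n, (c α
        * multiPow (Dbar G) β (fun w => dzbar i Φ w * g w) z) * τ α β)
      - dzbar i Φ z * ∑ α ∈ idx N n, ∑ β ∈ idx N n, (c α * multiPow (Dbar G) β g z) * τ α β
    = ∑ α ∈ idx N n, ∑ β ∈ idx N n,
        ((β i : ℂ) * c α * multiPow (Dbar G) (β - unitIdx i) g z) * τ α β := by
  have hv : Represents g (ofContDiffOn g hg) := represents_ofContDiffOn g hg
  rw [mul_sum, ← sum_sub_distrib]
  refine sum_congr rfl fun α _ => ?_
  rw [mul_sum, ← sum_sub_distrib]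
  refine sum_congr rfl fun β _ => ?_
  set x : V := ⟨z, hz⟩
  have e1 := H.represents_multiPow_dbar ((hΦ.dzbar i).mul hv) β x
  have e2 := H.represents_multiPow_dbar hv β x
  have e3 := H.represents_multiPow_dbar hv (β - unitIdx i) x
  have e4 := hΦ.dzbar i x
  rw [opPow_mul_of_const H.dbar_comm i (derZbar i φ) (fun j => H.dbar_potential i j)] at e1
  simp only [map_add, map_mul, map_smul, smul_eq_mul, ← e2, ← e3, ← e4] at e1
  change multiPow (Dbar G) β (fun w => dzbar i Φ w * g w) z = _ at e1
  rw [e1]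
  ring

end RepresentsMetric

theorem coeff_starSum {T : Coeffs N} {z : Cn N} {m n₀ : ℕ}
    (h : ∀ n ≥ n₀, ∀ α ∈ idx N n, ∀ β ∈ idx N n, PowerSeries.coeff m (T n α β z) = 0)
    (f g : Cn N → ℂ) : PowerSeries.coeff m (starSum G T f g z)
      = ∑ n ∈ range n₀, ∑ α ∈ idx N n, ∑ β ∈ idx N n,
          (multiPow (Dhol G) α f z * multiPow (Dbar G) β g z)
            * PowerSeries.coeff m (T n α β z) :=
  coeff_formalSum_smul h fun _ α β => multiPow (Dhol G) α f z * multiPow (Dbar G) β g z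

/-- The coefficients of the recurrence relation. -/
theorem coeff_succ_recurrence {T : Coeffs N} {z : Cn N} {m n₀ : ℕ}
    (h : ∀ n ≥ n₀, ∀ α ∈ idx N n, ∀ β ∈ idx N n, PowerSeries.coeff m (T n α β z) = 0)
    (h' : ∀ n ≥ n₀, ∀ α ∈ idx N n, ∀ β ∈ idx N n, PowerSeries.coeff (m + 1) (T n α β z) = 0)
    (f g : Cn N → ℂ) (i : Fin N) : PowerSeries.coeff (m + 1) (recurrence G T i f g z)
      = ∑ n ∈ range n₀, ((∑ α ∈ idx N n, ∑ β ∈ idx N n,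
          ((β i : ℂ) * multiPow (Dhol G) α f z * multiPow (Dbar G) (β - unitIdx i) g z)
            * PowerSeries.coeff (m + 1) (T n α β z))
      + (- (∑ α ∈ idx N n, ∑ β ∈ idx N n, (∑ d, G z d i * multiPow (Dhol G) (α + unitIdx d) f z
          * multiPow (Dbar G) β g z) * PowerSeries.coeff m (T n α β z))
      + (∑ α ∈ idx N n, ∑ β ∈ idx N n, (∑ k, ∑ p, (β k : ℂ) * ((β k : ℂ) - 1) / 2
          * curvMixed G p k k i z * multiPow (Dhol G) α f z
          * multiPow (Dbar G) (β + unitIdx p - 2 • unitIdx k) g z)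
            * PowerSeries.coeff m (T n α β z))
      + ∑ α ∈ idx N n, ∑ β ∈ idx N n, (∑ p, ∑ k, ∑ l ∈ Ioi k, (β k : ℂ) * (β l : ℂ)
          * curvMixed G p l k i z * multiPow (Dhol G) α f z
          * multiPow (Dbar G) (β + unitIdx p - unitIdx k - unitIdx l) g z)
            * PowerSeries.coeff m (T n α β z))) := by
  rw [recurrence, map_add, map_add, map_sub]
  simp only [PowerSeries.coeff_succ_X_mul, ← Finset.sum_smul]
  rw [coeff_formalSum_smul h', coeff_formalSum_smul h, coeff_formalSum_smul h,
    coeff_formalSum_smul h]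
  simp only [sum_add_distrib, sum_neg_distrib]
  ring

theorem coeff_zero_recurrence {T : Coeffs N} {z : Cn N} {n₀ : ℕ}
    (h : ∀ n ≥ n₀, ∀ α ∈ idx N n, ∀ β ∈ idx N n, PowerSeries.coeff 0 (T n α β z) = 0)
    (f g : Cn N → ℂ) (i : Fin N) : PowerSeries.coeff 0 (recurrence G T i f g z)
      = ∑ n ∈ range n₀, ∑ α ∈ idx N n, ∑ β ∈ idx N n,
          ((β i : ℂ) * multiPow (Dhol G) α f z * multiPow (Dbar G) (β - unitIdx i) g z)
            * PowerSeries.coeff 0 (T n α β z) := by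
  rw [recurrence, map_add, map_add, map_sub]
  simp only [PowerSeries.coeff_zero_X_mul]
  rw [coeff_formalSum_smul h]
  ring

/-- The commutator of an operator given by a parallel family of coefficients. -/
theorem commutator_starSum {Φ : Cn N → ℝ} (hΦ : IsPotential G V Φ)
    (hG : ∀ z ∈ V, (G z).det ≠ 0) (hR : IsParallel G V (curvTensor G)) {T : Coeffs N}
    (hT : IsCoeffFamily V T) (hP : CovariantlyConstant G V T) {f g : Cn N → ℂ}
    (hf : ContDiffOn ℝ ∞ f V) (hg : ContDiffOn ℝ ∞ g V) (i : Fin N) {z : Cn N} (hz : z ∈ V) :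
    commutator Φ i (starSum G T f) g z = recurrence G T i f g z := by
  have H := hΦ.representsMetric hG
  have hφ : Represents (fun w => (Φ w : ℂ)) hΦ.fn := represents_ofContDiffOn _ _
  ext m
  rw [commutator, map_sub, map_add, map_add, PowerSeries.coeff_smul, smul_eq_mul]
  cases m with
  | zero =>
    obtain ⟨n₀, h⟩ := hT.exists_bound 0 hz
    rw [coeff_zero_recurrence h, PowerSeries.coeff_zero_X_mul, PowerSeries.coeff_zero_X_mul,
      coeff_starSum h, coeff_starSum h, add_zero, add_zero, mul_sum, ← sum_sub_distrib]
    exact sum_congr rfl fun n _ => H.term_potential hφ hg i n _ _ hz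
  | succ m =>
    -- The coefficient of `ħ^(m+1)` is needed only at `z`, but that of `ħ^m` is differentiated, so
    -- its bound on `n` must hold in a neighbourhood.
    obtain ⟨n₁, h₁⟩ := hT.exists_bound (m + 1) hz
    obtain ⟨n₂, h₂⟩ := hT.locally_finite m z hz
    set n₀ := max n₁ n₂
    have h' : ∀ n ≥ n₀, ∀ α ∈ idx N n, ∀ β ∈ idx N n, PowerSeries.coeff (m + 1) (T n α β z) = 0 :=
      fun n hn => h₁ n (le_trans (le_max_left _ _) hn)
    have hev : ∀ᶠ w in 𝓝 z, ∀ n ≥ n₀, ∀ α ∈ idx N n, ∀ β ∈ idx N n,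
        PowerSeries.coeff m (T n α β w) = 0 :=
      h₂.mono fun w hw n hn => hw n (le_trans (le_max_right _ _) hn)
    have h := hev.self_of_nhds
    have hder : dzbar i (fun w => PowerSeries.coeff m (starSum G T f g w)) z
        = ∑ n ∈ range n₀, dzbar i (fun w => ∑ α ∈ idx N n, ∑ β ∈ idx N n,
          (multiPow (Dhol G) α f w * multiPow (Dbar G) β g w)
            * PowerSeries.coeff m (T n α β w)) z := by
      have hrep : ∀ n, Represents (fun w => ∑ α ∈ idx N n, ∑ β ∈ idx N n,
          (multiPow (Dhol G) α f w * multiPow (Dbar G) β g w)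
            * PowerSeries.coeff m (T n α β w))
          _ := fun n => H.represents_term hT (represents_ofContDiffOn f hf)
            (represents_ofContDiffOn g hg) n m
      have e1 := (Represents.sum (s := range n₀) fun n _ => hrep n).dzbar i ⟨z, hz⟩
      simp only [map_sum] at e1
      have e2 : ∀ n, _ := fun n => (hrep n).dzbar i ⟨z, hz⟩
      simp only [map_sum] at e2
      simp only [e2]
      rw [← e1]
      have : (fun w => PowerSeries.coeff m (starSum G T f g w)) =ᶠ[𝓝 z]
          fun w => ∑ n ∈ range n₀, ∑ α ∈ idx N n, ∑ β ∈ idx N n,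
            (multiPow (Dhol G) α f w * multiPow (Dbar G) β g w)
              * PowerSeries.coeff m (T n α β w) :=
        hev.mono fun w hw => coeff_starSum hw f g
      simp only [dzbar, this.fderiv_eq]
    rw [coeff_succ_recurrence h h', PowerSeries.coeff_succ_X_mul, PowerSeries.coeff_succ_X_mul,
      PowerSeries.coeff_mk, hder, coeff_starSum h', coeff_starSum h, coeff_starSum h',
      add_sub_add_comm, mul_sum, ← sum_sub_distrib, ← sum_sub_distrib, ← sum_add_distrib]
    refine sum_congr rfl fun n _ => ?_
    rw [H.term_bracket hT hP hR (represents_ofContDiffOn f hf) (represents_ofContDiffOn g hg) i n m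
      ⟨z, hz⟩]
    congr 1
    exact H.term_potential hφ hg i n _ _ hz

end Commutator

/-! ### Test functions dual to the operators `D^α` and `D^{β*}`. -/

section TestFunctions

variable {N : ℕ}

section Taylor

variable {A : Type*} [CommRing A] [Algebra ℂ A]

theorem opPow_add_unitIdx' {D : Fin N → Derivation ℂ A A}
    (hD : ∀ j k u, D j (D k u) = D k (D j u)) (β : Fin N → ℕ) (j : Fin N) (u : A) :
    opPow D (β + unitIdx j) u = opPow D β (D j u) := by
  -- The bracket formula with `ε = D j`, whose brackets with all `D k` vanish, moves the extra
  -- factor to the innermost place.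
  have h := opPow_bracket hD (D j) 0 0 (fun k u => by simp [hD k j]) (by simp) (by simp)
    (by simp) u β
  rw [opPow_add_unitIdx hD, h]
  simp

theorem derivation_aeval {D : Fin N → Derivation ℂ A A} {y : Fin N → A}
    (hy : ∀ j i, D j (y i) = if j = i then 1 else 0) (j : Fin N)
    (P : MvPolynomial (Fin N) ℂ) :
    D j (MvPolynomial.aeval y P) = MvPolynomial.aeval y (MvPolynomial.pderiv j P) := by
  induction P using MvPolynomial.induction_on with
  | C c => simp
  | add p q hp hq => simp only [map_add, hp, hq]
  | mul_X P i hP =>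
    rw [map_mul, Derivation.leibniz, hP, Derivation.leibniz, map_add, MvPolynomial.aeval_X, hy,
      MvPolynomial.pderiv_X]
    by_cases hji : j = i
    · subst hji; simp
    · simp [hji, Ne.symm hji]

/-- Taylor coefficients with respect to coordinates `y_i` dual to commuting derivations. -/
theorem map_opPow_aeval {D : Fin N → Derivation ℂ A A}
    (hD : ∀ j k u, D j (D k u) = D k (D j u)) {y : Fin N → A}
    (hy : ∀ j i, D j (y i) = if j = i then 1 else 0) {ev : A →ₐ[ℂ] ℂ} (hev : ∀ i, ev (y i) = 0)
    (P : MvPolynomial (Fin N) ℂ) (α : Fin N → ℕ) :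
    ev (opPow D α (MvPolynomial.aeval y P))
      = ((∏ k, (α k).factorial : ℕ) : ℂ) * P.coeff (Finsupp.equivFunOnFinite.symm α) := by
  obtain ⟨s, hs⟩ : ∃ s, ∑ k, α k = s := ⟨_, rfl⟩
  induction s generalizing α P with
  | zero =>
    have h0 : α = 0 := funext fun k => (Finset.sum_eq_zero_iff.1 hs) k (mem_univ k)
    subst h0
    have h1 : (Finsupp.equivFunOnFinite.symm (0 : Fin N → ℕ)) = 0 := by ext; simp
    rw [opPow_zero, h1]
    have h2 : (ev.comp (MvPolynomial.aeval y)) = MvPolynomial.aeval (fun _ => (0 : ℂ)) := by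
      ext i; simp [hev]
    have h3 := DFunLike.congr_fun h2 P
    rw [AlgHom.comp_apply] at h3
    rw [h3]
    simp [MvPolynomial.aeval_zero', MvPolynomial.constantCoeff_eq]
  | succ s ih =>
    obtain ⟨j, hj⟩ : ∃ j, α j ≠ 0 := by
      by_contra! hc
      simp [hc] at hs
    obtain ⟨α', rfl⟩ : ∃ α', α = α' + unitIdx j := ⟨_, (tsub_unitIdx_add_unitIdx hj).symm⟩
    rw [sum_add_unitIdx] at hs
    have h1 : (Finsupp.equivFunOnFinite.symm (α' + unitIdx j))
        = Finsupp.equivFunOnFinite.symm α' + Finsupp.single j 1 := by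
      ext k; simp [unitIdx, Finsupp.single_apply, Pi.single_apply, eq_comm]
    rw [opPow_add_unitIdx' hD, derivation_aeval hy, ih _ α' (by omega), MvPolynomial.coeff_pderiv,
      prod_factorial_add_unitIdx, h1]
    simp [unitIdx]
    ring

/-- The function is `y^γ / γ!`, as in Taylor's formula. -/
theorem exists_dual {D : Fin N → Derivation ℂ A A}
    (hD : ∀ j k u, D j (D k u) = D k (D j u)) {y : Fin N → A}
    (hy : ∀ j i, D j (y i) = if j = i then 1 else 0) {ev : A →ₐ[ℂ] ℂ} (hev : ∀ i, ev (y i) = 0)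
    (γ : Fin N → ℕ) : ∃ u : A, ∀ α, ev (opPow D α u) = if α = γ then 1 else 0 := by
  refine ⟨MvPolynomial.aeval y (MvPolynomial.monomial (Finsupp.equivFunOnFinite.symm γ)
    ((∏ k, (γ k).factorial : ℕ) : ℂ)⁻¹), fun α => ?_⟩
  rw [map_opPow_aeval hD hy hev, MvPolynomial.coeff_monomial]
  by_cases h : α = γ
  · subst h
    rw [if_pos rfl, if_pos rfl]
    exact mul_inv_cancel₀ (Nat.cast_ne_zero.2 (prod_ne_zero_iff.2 fun x _ =>
      Nat.factorial_ne_zero _))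
  · rw [if_neg h, if_neg, mul_zero]
    exact fun h' => h (Finsupp.equivFunOnFinite.symm.injective h').symm

end Taylor

theorem multiPow_eventuallyEq {B : Fin N → (Cn N → ℂ) → Cn N → ℂ} {z : Cn N}
    (hB : ∀ k (f g : Cn N → ℂ), f =ᶠ[𝓝 z] g → B k f =ᶠ[𝓝 z] B k g) {f g : Cn N → ℂ}
    (h : f =ᶠ[𝓝 z] g) (α : Fin N → ℕ) : multiPow B α f =ᶠ[𝓝 z] multiPow B α g := by
  rw [multiPow, multiPow, List.ofFn_eq_map]
  induction List.finRange N with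
  | nil => exact h
  | cons k l ih =>
    simp only [List.map_cons, List.foldr_cons]
    induction α k with
    | zero => exact ih
    | succ n hn =>
      rw [Function.iterate_succ_apply', Function.iterate_succ_apply']
      exact hB k _ _ hn

theorem dz_eventuallyEq {f g : Cn N → ℂ} {z : Cn N} (h : f =ᶠ[𝓝 z] g) (k : Fin N) :
    dz k f =ᶠ[𝓝 z] dz k g := (h.fderiv (𝕜 := ℝ)).mono fun w hw => by simp only [dz, hw]

theorem dzbar_eventuallyEq {f g : Cn N → ℂ} {z : Cn N} (h : f =ᶠ[𝓝 z] g) (k : Fin N) :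
    dzbar k f =ᶠ[𝓝 z] dzbar k g := (h.fderiv (𝕜 := ℝ)).mono fun w hw => by simp only [dzbar, hw]

theorem dbar_eventuallyEq (G : Cn N → Matrix (Fin N) (Fin N) ℂ) {z : Cn N} (k : Fin N)
    (f g : Cn N → ℂ) (h : f =ᶠ[𝓝 z] g) : Dbar G k f =ᶠ[𝓝 z] Dbar G k g := by
  filter_upwards [Filter.eventually_all.2 fun l => dz_eventuallyEq h l] with w hw
  simp only [Dbar, hw]

theorem dhol_eventuallyEq (G : Cn N → Matrix (Fin N) (Fin N) ℂ) {z : Cn N} (k : Fin N)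
    (f g : Cn N → ℂ) (h : f =ᶠ[𝓝 z] g) : Dhol G k f =ᶠ[𝓝 z] Dhol G k g := by
  filter_upwards [Filter.eventually_all.2 fun l => dzbar_eventuallyEq h l] with w hw
  simp only [Dhol, hw]

/-- A function that is smooth near a point agrees there with a globally smooth function. -/
theorem exists_contDiff_eventuallyEq {V : TopologicalSpace.Opens (Cn N)} {f : Cn N → ℂ}
    (hf : ContDiffOn ℝ ∞ f V) {z : Cn N} (hz : z ∈ V) :
    ∃ F : Cn N → ℂ, ContDiff ℝ ∞ F ∧ F =ᶠ[𝓝 z] f := by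
  obtain ⟨r, hr, hrV⟩ := Metric.nhds_basis_closedBall.mem_iff.1 (V.isOpen.mem_nhds hz)
  let χ : ContDiffBump z := ⟨r / 2, r, by linarith, by linarith⟩
  refine ⟨fun w => χ w • f w, contDiff_iff_contDiffAt.2 fun w => ?_, ?_⟩
  · by_cases hw : w ∈ V
    · exact χ.contDiffAt.smul (hf.contDiffAt (V.isOpen.mem_nhds hw))
    · have h1 : w ∉ tsupport χ := fun h => hw (hrV (χ.tsupport_eq ▸ h))
      have h2 : (fun w => χ w • f w) =ᶠ[𝓝 w] fun _ => 0 := by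
        filter_upwards [notMem_tsupport_iff_eventuallyEq.1 h1] with v hv
        rw [hv]; simp
      exact contDiffAt_const.congr_of_eventuallyEq h2
  · filter_upwards [χ.eventuallyEq_one] with w hw
    rw [hw]; simp

variable {V : TopologicalSpace.Opens (Cn N)} {G : Cn N → Matrix (Fin N) (Fin N) ℂ}

namespace RepresentsMetric

variable {φ : SmoothFun V} (H : RepresentsMetric G φ)
include H

/-- The dual coordinates are the `∂_iΦ` minus their values at `z`. They exist only where the
potential does, whereas the recurrence is tested on functions smooth on the whole chart domain,
hence the cutoff. -/
theorem exists_dual_dhol {z : Cn N} (hz : z ∈ V) (γ : Fin N → ℕ) :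
    ∃ f : Cn N → ℂ, ContDiff ℝ ∞ f ∧
      ∀ α, multiPow (Dhol G) α f z = if α = γ then 1 else 0 := by
  obtain ⟨u, hu⟩ := exists_dual (y := fun i => derZ i φ
    - algebraMap ℂ _ (evalAt ⟨z, hz⟩ (derZ i φ))) (ev := evalAt ⟨z, hz⟩) H.dhol_comm
    (fun j i => by rw [map_sub, H.dhol_potential, Derivation.map_algebraMap, sub_zero])
    (fun i => by rw [map_sub, AlgHom.commutes]; exact sub_self _) γ
  obtain ⟨f, hf, hfu⟩ := exists_represents u
  obtain ⟨F, hF, hFf⟩ := exists_contDiff_eventuallyEq hf hz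
  refine ⟨F, hF, fun α => ?_⟩
  rw [(multiPow_eventuallyEq (dhol_eventuallyEq G) hFf α).self_of_nhds, ← hu α]
  exact H.represents_multiPow_dhol hfu α ⟨z, hz⟩

theorem exists_dual_dbar {z : Cn N} (hz : z ∈ V) (γ : Fin N → ℕ) :
    ∃ f : Cn N → ℂ, ContDiff ℝ ∞ f ∧
      ∀ α, multiPow (Dbar G) α f z = if α = γ then 1 else 0 := by
  obtain ⟨u, hu⟩ := exists_dual (y := fun i => derZbar i φ
    - algebraMap ℂ _ (evalAt ⟨z, hz⟩ (derZbar i φ))) (ev := evalAt ⟨z, hz⟩) H.dbar_comm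
    (fun j i => by rw [map_sub, H.dbar_potential, Derivation.map_algebraMap, sub_zero])
    (fun i => by rw [map_sub, AlgHom.commutes]; exact sub_self _) γ
  obtain ⟨f, hf, hfu⟩ := exists_represents u
  obtain ⟨F, hF, hFf⟩ := exists_contDiff_eventuallyEq hf hz
  refine ⟨F, hF, fun α => ?_⟩
  rw [(multiPow_eventuallyEq (dbar_eventuallyEq G) hFf α).self_of_nhds, ← hu α]
  exact H.represents_multiPow_dbar hfu α ⟨z, hz⟩

end RepresentsMetric

theorem multiPow_const {B : Fin N → (Cn N → ℂ) → Cn N → ℂ} (hB : ∀ k c, B k (fun _ => c) = fun _ => 0)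
    (c : ℂ) (α : Fin N → ℕ) : multiPow B α (fun _ => c) = if α = 0 then fun _ => c else fun _ => 0 := by
  have key : ∀ l : List (Fin N), (l.map fun k => (B k)^[α k]).foldr (fun A h => A h) (fun _ => c)
      = if ∀ k ∈ l, α k = 0 then fun _ => c else fun _ => 0 := by
    intro l
    induction l with
    | nil => simp
    | cons k l ih =>
      simp only [List.map_cons, List.foldr_cons, ih, List.forall_mem_cons]
      have h0 : ∀ d : ℂ, ∀ n : ℕ, (B k)^[n] (fun _ => d) = if n = 0 then fun _ => d else fun _ => 0 := by
        intro d n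
        induction n with
        | zero => rfl
        | succ n hn =>
          rw [Function.iterate_succ_apply', hn, if_neg n.succ_ne_zero]
          split_ifs
          · exact hB k d
          · exact hB k 0
      have h1 := h0 0 (α k)
      by_cases h : ∀ k ∈ l, α k = 0
      · rw [if_pos h, h0]
        by_cases hk : α k = 0
        · rw [if_pos hk, if_pos ⟨hk, h⟩]
        · rw [if_neg hk, if_neg fun h => hk h.1]
      · rw [if_neg h, if_neg fun h' => h h'.2]
        exact h1.trans (ite_self _)
  have := key (List.finRange N)
  rw [← List.ofFn_eq_map] at this
  rw [multiPow, this]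
  congr 1
  simp [funext_iff]

end TestFunctions

/-! ### The recurrence determines the coefficients. -/

section Uniqueness

variable {N : ℕ} {G : Cn N → Matrix (Fin N) (Fin N) ℂ}

/-- The leading part of the recurrence relation on dual test functions. -/
theorem sum_leading_dual {n n₀ : ℕ} (hn : n < n₀) {α₀ β₀ : Fin N → ℕ} (hα : α₀ ∈ idx N n)
    (hβ : β₀ ∈ idx N n) {i : Fin N} (hi : β₀ i ≠ 0) {X Y : (Fin N → ℕ) → ℂ}
    (hX : ∀ α, X α = if α = α₀ then 1 else 0)
    (hY : ∀ β, Y β = if β = β₀ - unitIdx i then 1 else 0)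
    (F : ℕ → (Fin N → ℕ) → (Fin N → ℕ) → ℂ) :
    ∑ n ∈ range n₀, ∑ α ∈ idx N n, ∑ β ∈ idx N n, ((β i : ℂ) * X α * Y (β - unitIdx i)) * F n α β
      = β₀ i * F n α₀ β₀ := by
  rw [sum_eq_single_of_mem n (mem_range.2 hn), sum_eq_single_of_mem α₀ hα,
    sum_eq_single_of_mem β₀ hβ]
  · simp [hX, hY]
  · intro β _ hne
    by_cases h0 : β i = 0
    · simp [h0]
    · rw [hY, if_neg, mul_zero, zero_mul]
      intro h
      exact hne (by rw [← tsub_unitIdx_add_unitIdx h0, h, tsub_unitIdx_add_unitIdx hi])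
  · intro α _ hne
    refine sum_eq_zero fun β _ => ?_
    rw [hX, if_neg hne]; simp
  · intro n' _ hne
    refine sum_eq_zero fun α hα' => sum_eq_zero fun β _ => ?_
    have : α ≠ α₀ := by
      rintro rfl
      exact hne ((mem_idx.1 hα').symm.trans (mem_idx.1 hα))
    rw [hX, if_neg this]; simp

/-- The recurrence relations at a point determine the coefficients. -/
theorem coeff_unique {V : TopologicalSpace.Opens (Cn N)} {φ : SmoothFun V}
    (H : RepresentsMetric G φ) {z : Cn N} (hz : z ∈ V) {U : Set (Cn N)} (hzU : z ∈ U)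
    {T T' : Coeffs N} (hT : IsCoeffFamily U T) (hT' : IsCoeffFamily U T')
    (h0 : T' 0 0 0 z = T 0 0 0 z) (hr : SatisfiesRecurrence G U T)
    (hr' : SatisfiesRecurrence G U T') (m : ℕ) :
    ∀ n, ∀ α ∈ idx N n, ∀ β ∈ idx N n,
      PowerSeries.coeff m (T' n α β z) = PowerSeries.coeff m (T n α β z) := by
  -- For `n = 0` there is no `i` with `β i ≠ 0` and the recurrence does not isolate `T^0`; this is
  -- where the normalization enters.
  have hzero : ∀ m, ∀ α ∈ idx N 0, ∀ β ∈ idx N 0,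
      PowerSeries.coeff m (T' 0 α β z) = PowerSeries.coeff m (T 0 α β z) := by
    intro m α hα β hβ
    have e : ∀ γ ∈ idx N 0, γ = 0 := fun γ hγ =>
      funext fun k => (Finset.sum_eq_zero_iff.1 (mem_idx.1 hγ)) k (mem_univ k)
    rw [e α hα, e β hβ, h0]
  have hpos : ∀ n ≠ 0, ∀ β ∈ idx N n, ∃ i, β i ≠ 0 := by
    intro n hn β hβ
    by_contra! hc
    exact hn (by rw [← mem_idx.1 hβ]; simp [hc])
  induction m with
  | zero =>
    intro n α hα β hβ
    rcases eq_or_ne n 0 with rfl | hn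
    · exact hzero 0 α hα β hβ
    obtain ⟨i, hi⟩ := hpos n hn β hβ
    obtain ⟨f, hf, hfα⟩ := H.exists_dual_dhol hz α
    obtain ⟨g, hg, hgβ⟩ := H.exists_dual_dbar hz (β - unitIdx i)
    obtain ⟨n₁, h₁⟩ := hT.exists_bound 0 hzU
    obtain ⟨n₂, h₂⟩ := hT'.exists_bound 0 hzU
    have hn₀ : n < max (max n₁ n₂) (n + 1) := lt_of_lt_of_le n.lt_succ_self (le_max_right _ _)
    have hb := fun k (hk : k ≥ max (max n₁ n₂) (n + 1)) => h₁ k (by omega)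
    have hb' := fun k (hk : k ≥ max (max n₁ n₂) (n + 1)) => h₂ k (by omega)
    have e := coeff_zero_recurrence (G := G) hb f g i
    have e' := coeff_zero_recurrence (G := G) hb' f g i
    rw [hr f g hf.contDiffOn hg.contDiffOn i z hzU, sum_leading_dual hn₀ hα hβ hi hfα hgβ
      fun n α β => PowerSeries.coeff 0 (T n α β z)] at e
    rw [hr' f g hf.contDiffOn hg.contDiffOn i z hzU, sum_leading_dual hn₀ hα hβ hi hfα hgβ
      fun n α β => PowerSeries.coeff 0 (T' n α β z)] at e'
    exact mul_left_cancel₀ (Nat.cast_ne_zero.2 hi) (e'.symm.trans e)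
  | succ m ih =>
    intro n α hα β hβ
    rcases eq_or_ne n 0 with rfl | hn
    · exact hzero _ α hα β hβ
    obtain ⟨i, hi⟩ := hpos n hn β hβ
    obtain ⟨f, hf, hfα⟩ := H.exists_dual_dhol hz α
    obtain ⟨g, hg, hgβ⟩ := H.exists_dual_dbar hz (β - unitIdx i)
    obtain ⟨n₁, h₁⟩ := hT.exists_bound m hzU
    obtain ⟨n₂, h₂⟩ := hT'.exists_bound m hzU
    obtain ⟨n₃, h₃⟩ := hT.exists_bound (m + 1) hzU
    obtain ⟨n₄, h₄⟩ := hT'.exists_bound (m + 1) hzU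
    obtain ⟨n₀, hn₀, l₁, l₂, l₃, l₄⟩ : ∃ n₀, n < n₀ ∧ n₁ ≤ n₀ ∧ n₂ ≤ n₀ ∧ n₃ ≤ n₀ ∧ n₄ ≤ n₀ :=
      ⟨n + 1 + n₁ + n₂ + n₃ + n₄, by omega, by omega, by omega, by omega, by omega⟩
    have e := coeff_succ_recurrence (G := G) (fun k hk => h₁ k (l₁.trans hk))
      (fun k hk => h₃ k (l₃.trans hk)) f g i
    have e' := coeff_succ_recurrence (G := G) (fun k hk => h₂ k (l₂.trans hk))
      (fun k hk => h₄ k (l₄.trans hk)) f g i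
    rw [hr f g hf.contDiffOn hg.contDiffOn i z hzU, sum_add_distrib,
      sum_leading_dual hn₀ hα hβ hi hfα hgβ
      fun n α β => PowerSeries.coeff (m + 1) (T n α β z)] at e
    rw [hr' f g hf.contDiffOn hg.contDiffOn i z hzU, sum_add_distrib,
      sum_leading_dual hn₀ hα hβ hi hfα hgβ
      fun n α β => PowerSeries.coeff (m + 1) (T' n α β z)] at e'
    refine mul_left_cancel₀ (Nat.cast_ne_zero.2 hi) (add_right_cancel ((e'.symm.trans e).trans ?_))
    -- What remains contains `T` and `T'` only through their coefficients at `ħ^m`, which agree by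
    -- induction.
    congr 1
    refine sum_congr rfl fun k _ => ?_
    refine congrArg₂ (· + ·) (congrArg₂ (· + ·) (congrArg Neg.neg ?_) ?_) ?_ <;>
      exact sum_congr rfl fun a ha => sum_congr rfl fun b hb => by rw [ih k a ha b hb]

end Uniqueness

/-! ### Passage to the manifold: nondegeneracy in charts and the star product. -/

section Manifold

variable {N : ℕ} {M : Type*} [TopologicalSpace M] [ChartedSpace (Cn N) M]

theorem mfderiv_symm_injective [IsManifold 𝓘(ℂ, Cn N) ω M]
    {e : OpenPartialHomeomorph M (Cn N)} (he : e ∈ holCharts N M) {z : Cn N} (hz : z ∈ e.target) :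
    Function.Injective (mfderiv 𝓘(ℂ, Cn N) 𝓘(ℂ, Cn N) e.symm z) := by
  have hd : e.MDifferentiable 𝓘(ℂ, Cn N) 𝓘(ℂ, Cn N) :=
    ⟨(contMDiffOn_of_mem_maximalAtlas he).mdifferentiableOn (by simp),
      (contMDiffOn_symm_of_mem_maximalAtlas he).mdifferentiableOn (by simp)⟩
  exact (hd.symm.mfderiv_bijective hz).1

theorem sesqForm_eq_zero {E : Type*} [AddCommGroup E] [Module ℂ E] (B : E →ₗ[ℂ] E →ₗ⋆[ℂ] ℂ)
    (L : Cn N →ₗ[ℂ] E) (v : Cn N)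
    (h : ∀ l, ∑ k, v k * B (L (Pi.single k 1)) (L (Pi.single l 1)) = 0) :
    B (L v) (L v) = 0 := by
  have hv : L v = ∑ k, v k • L (Pi.single k 1) := by
    conv_lhs => rw [pi_eq_sum_univ' v, map_sum]
    refine sum_congr rfl fun k _ => ?_
    rw [map_smul]
  have h1 : ∀ l, B (L v) (L (Pi.single l 1)) = 0 := by
    intro l
    rw [← h l]
    simp [hv, LinearMap.sum_apply]
  generalize L v = w at h1 hv
  have h2 : B w (∑ k, v k • L (Pi.single k 1)) = 0 := by
    simp [h1]
  rwa [← hv] at h2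

/-- A null vector of the matrix would give a tangent vector of length zero, nonzero because the
differential of the inverse chart is injective. -/
theorem KahlerMetric.det_coord_ne_zero [IsManifold 𝓘(ℂ, Cn N) ω M] (h : KahlerMetric N M)
    {e : OpenPartialHomeomorph M (Cn N)} (he : e ∈ holCharts N M) {z : Cn N} (hz : z ∈ e.target) :
    (h.coord e z).det ≠ 0 := by
  intro hdet
  obtain ⟨v, hv, hv0⟩ := Matrix.exists_vecMul_eq_zero_iff.2 hdet
  set L := mfderiv 𝓘(ℂ, Cn N) 𝓘(ℂ, Cn N) e.symm z with hL
  have hne : L v ≠ 0 := fun h0 =>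
    hv (mfderiv_symm_injective he hz (h0.trans (map_zero L).symm))
  have hpos := h.pos _ _ hne
  have hform : h.form (e.symm z) (L v) (L v) = 0 :=
    sesqForm_eq_zero (h.form (e.symm z)) L.toLinearMap v fun l => congrFun hv0 l
  rw [hform] at hpos
  simp at hpos

/-- Only `L g` is differentiated, so only there is agreement near the point required. -/
theorem commutator_congr {Φ : Cn N → ℝ} {i : Fin N} {L L' : (Cn N → ℂ) → Cn N → ℂ⟦X⟧}
    {g : Cn N → ℂ} {z : Cn N}
    (h1 : L (fun w => dzbar i (fun v => (Φ v : ℂ)) w * g w) z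
      = L' (fun w => dzbar i (fun v => (Φ v : ℂ)) w * g w) z)
    (h2 : L (dzbar i g) z = L' (dzbar i g) z) (h3 : ∀ᶠ w in 𝓝 z, L g w = L' g w) :
    commutator Φ i L g z = commutator Φ i L' g z := by
  have h4 : ∀ m, dzbar i (fun w => PowerSeries.coeff m (L g w)) z
      = dzbar i (fun w => PowerSeries.coeff m (L' g w)) z := fun m =>
    (dzbar_eventuallyEq (h3.mono fun w hw => by rw [hw]) i).self_of_nhds
  simp only [commutator, h1, h2, h3.self_of_nhds, h4]

theorem StarProduct.satisfiesRecurrence [IsManifold 𝓘(ℂ, Cn N) ω M] {h : KahlerMetric N M}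
    (hsym : h.IsLocallySymmetric) {e : OpenPartialHomeomorph M (Cn N)} (he : e ∈ holCharts N M)
    (S : StarProduct h) (hS : S.IsKarabegov) {T : Coeffs N} (hT : IsCoeffFamily e.target T)
    (hP : CovariantlyConstant (h.coord e) e.target T) (hST : S.HasForm e T) {V : Set (Cn N)}
    (hV : IsOpen V) (hVe : V ⊆ e.target) : SatisfiesRecurrence (h.coord e) V T := by
  intro f g hf hg i z hz
  obtain ⟨W, hW, hzW, hWe, Φ, hΦ⟩ := h.potential e he z (hVe hz)
  -- The recurrence does not involve the potential and is checked pointwise, so a potential near `z`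
  -- suffices.
  let O : TopologicalSpace.Opens (Cn N) := ⟨V ∩ W, hV.inter hW⟩
  have hOe : (O : Set (Cn N)) ⊆ e.target := fun w hw => hVe hw.1
  have hzO : z ∈ O := ⟨hz, hzW⟩
  have hΦO : IsPotential (h.coord e) O Φ :=
    ⟨hΦ.1.mono Set.inter_subset_right, fun w hw => hΦ.2 w hw.2⟩
  have hfO : ContDiffOn ℝ ∞ f O := hf.mono Set.inter_subset_left
  have hgO : ContDiffOn ℝ ∞ g O := hg.mono Set.inter_subset_left
  have hgr := represents_ofContDiffOn g hgO
  have hΦr := represents_ofContDiffOn _ hΦO.contDiffOn_ofReal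
  rw [← commutator_starSum hΦO (fun w hw => h.det_coord_ne_zero he (hOe hw))
    (fun m I J w hw => hsym e he m I J w (hOe hw)) (hT.mono hOe)
    (fun n m k I J w hw => hP n m k I J w (hOe hw)) hfO hgO i hzO,
    ← hS e he O O.isOpen hOe Φ hΦO f g hfO hgO i z hzO]
  refine commutator_congr ?_ ?_ ?_
  · exact (hST O O.isOpen hOe f _ hfO ((hΦr.dzbar i).mul hgr).contDiffOn z hzO).symm
  · exact (hST O O.isOpen hOe f _ hfO (hgr.dzbar i).contDiffOn z hzO).symm
  · filter_upwards [O.isOpen.mem_nhds hzO] with w hw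
    exact (hST O O.isOpen hOe f g hfO hgO w hw).symm

theorem starSum_one_one {G : Cn N → Matrix (Fin N) (Fin N) ℂ} {U : Set (Cn N)} {T : Coeffs N}
    (hT : IsCoeffFamily U T) {z : Cn N} (hz : z ∈ U) :
    starSum G T (fun _ => 1) (fun _ => 1) z = T 0 0 0 z := by
  ext m
  obtain ⟨n₀, hn₀⟩ := hT.exists_bound m hz
  rw [coeff_starSum (n₀ := n₀ + 1) fun n hn => hn₀ n (by omega)]
  have hdz : ∀ (c : ℂ) k, dz (N := N) k (fun _ => c) = fun _ => 0 := by
    intro c k; funext w; simp [dz]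
  have hdzbar : ∀ (c : ℂ) k, dzbar (N := N) k (fun _ => c) = fun _ => 0 := by
    intro c k; funext w; simp [dzbar]
  have h1 : ∀ α, multiPow (Dhol G) α (fun _ => 1) z = if α = 0 then 1 else 0 := by
    intro α
    rw [multiPow_const fun k c => by funext w; simp [Dhol, hdzbar]]
    split_ifs <;> rfl
  have h2 : ∀ β, multiPow (Dbar G) β (fun _ => 1) z = if β = 0 then 1 else 0 := by
    intro α
    rw [multiPow_const fun k c => by funext w; simp [Dbar, hdz]]
    split_ifs <;> rfl
  have hmem : (0 : Fin N → ℕ) ∈ idx N 0 := by simp [mem_idx]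
  rw [sum_eq_single_of_mem 0 (by simp), sum_eq_single_of_mem 0 hmem, sum_eq_single_of_mem 0 hmem]
  · simp [h1, h2]
  · intro β _ hβ
    rw [h2, if_neg hβ]; simp
  · intro α _ hα
    exact sum_eq_zero fun β _ => by rw [h1, if_neg hα]; simp
  · intro n _ hn
    refine sum_eq_zero fun α hα => sum_eq_zero fun β _ => ?_
    have : α ≠ 0 := by
      rintro rfl
      exact hn (by simpa using (mem_idx.1 hα).symm)
    rw [h1, if_neg this]; simp

/-- Evaluate `1 * 1 = 1`: all derivatives of constants vanish, and only `T^0` survives. -/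
theorem StarProduct.coeffs_zero {h : KahlerMetric N M} {e : OpenPartialHomeomorph M (Cn N)}
    (S : StarProduct h) {T : Coeffs N} (hT : IsCoeffFamily e.target T) (hST : S.HasForm e T)
    {z : Cn N} (hz : z ∈ e.target) : T 0 0 0 z = 1 := by
  rw [← starSum_one_one (G := h.coord e) hT hz, ← hST e.target e.open_target subset_rfl
    (fun _ => 1) (fun _ => 1) contDiffOn_const contDiffOn_const z hz]
  ext m
  have := (S.unit Set.univ isOpen_univ (fun _ => 1) contMDiffOn_const m (e.symm z) trivial).1
  rw [StarProduct.coord, PowerSeries.coeff_mk, PowerSeries.coeff_one]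
  exact this

end Manifold

end KahlerStar

end

theorem mainTheorem3 {N : ℕ} {M : Type*} [TopologicalSpace M]
    [ChartedSpace (KahlerStar.Cn N) M] [IsManifold 𝓘(ℂ, KahlerStar.Cn N) ω M]
    (h : KahlerStar.KahlerMetric N M) (hsym : h.IsLocallySymmetric)
    (e : OpenPartialHomeomorph M (KahlerStar.Cn N)) (he : e ∈ KahlerStar.holCharts N M) :
    -- the commutator of an operator of the given form, computed explicitly
    (∀ V : Set (KahlerStar.Cn N), IsOpen V → V ⊆ e.target →
      ∀ Φ : KahlerStar.Cn N → ℝ, KahlerStar.IsPotential (h.coord e) V Φ →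
      ∀ T : KahlerStar.Coeffs N, KahlerStar.IsCoeffFamily V T →
        KahlerStar.CovariantlyConstant (h.coord e) V T →
      ∀ f g : KahlerStar.Cn N → ℂ, ContDiffOn ℝ ∞ f V → ContDiffOn ℝ ∞ g V →
      ∀ i, ∀ z ∈ V,
        KahlerStar.commutator Φ i (KahlerStar.starSum (h.coord e) T f) g z =
          KahlerStar.recurrence (h.coord e) T i f g z) ∧
    -- the recurrence relations of the star product; they determine its coefficients
    (∀ S : KahlerStar.StarProduct h, S.SeparatesVariables → S.IsKarabegov →
      ∀ T : KahlerStar.Coeffs N, KahlerStar.IsCoeffFamily e.target T →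
        KahlerStar.CovariantlyConstant (h.coord e) e.target T → S.HasForm e T →
      (∀ V : Set (KahlerStar.Cn N), IsOpen V → V ⊆ e.target →
        KahlerStar.SatisfiesRecurrence (h.coord e) V T) ∧
      (∀ T' : KahlerStar.Coeffs N, KahlerStar.IsCoeffFamily e.target T' →
        (∀ z ∈ e.target, T' 0 0 0 z = 1) →
        KahlerStar.SatisfiesRecurrence (h.coord e) e.target T' →
        ∀ n, ∀ α ∈ KahlerStar.idx N n, ∀ β ∈ KahlerStar.idx N n, ∀ z ∈ e.target,
          T' n α β z = T n α β z)) := by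
  refine ⟨fun V hV hVe Φ hΦ T hT hP f g hf hg i z hz => ?_,
    fun S _ hS T hT hP hST => ⟨fun V hV hVe =>
      S.satisfiesRecurrence hsym he hS hT hP hST hV hVe, fun T' hT' h0 hr n α hα β hβ z hz => ?_⟩⟩
  · exact KahlerStar.commutator_starSum (V := ⟨V, hV⟩) hΦ
      (fun w hw => h.det_coord_ne_zero he (hVe hw))
      (fun m I J w hw => hsym e he m I J w (hVe hw)) hT hP hf hg i hz
  · obtain ⟨W, hW, hzW, hWe, Φ, hΦ⟩ := h.potential e he z hz
    have H := KahlerStar.IsPotential.representsMetric (V := ⟨W, hW⟩) hΦ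
      fun w hw => h.det_coord_ne_zero he (hWe hw)
    ext m
    exact KahlerStar.coeff_unique H hzW hz hT hT' ((h0 z hz).trans (S.coeffs_zero hT hST hz).symm)
      (S.satisfiesRecurrence hsym he hS hT hP hST e.open_target subset_rfl) hr m n α hα β hβ
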